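/- **Setting.** Let $\Xi$ be a standard Borel space with set of probability measures $\mathcal P_\Xi$. Let $S$ groups with sample sizes $N_1,\dots,N_S$ be given, $N=\sum_\ell N_\ell$, and fix a group $s$ with $N_s\ge 1$. The observations $\xi_{\ell j}$ ($1\le \ell\le S$, $1\le j\le N_\ell$) are independent $\Xi$-valued random variables on a probability space with measure $\mathbb P$, and $\xi_{\ell j}\sim p_\ell^\star$, where every $p^\star_\ell\in\mathcal P_\Xi$ is diffuse (has no atoms). Write $\boldsymbol\xi_\ell=(\xi_{\ell 1},\dots,\xi_{\ell N_\ell})$, $\boldsymbol\xi^N=(\boldsymbol\xi_1,\dots,\boldsymbol\xi_S)$ and $p_{\boldsymbol\xi_s}=\frac1{N_s}\sum_{j}\delta_{\xi_{sj}}$. Let $\mathrm{DP}(\alpha,P)$ be the Dirichlet process, i.e. the law of a random $p\in\mathcal P_\Xi$ such that $(p(A_1),\dots,p(A_k))\sim\mathrm{Dirichlet}(\alpha P(A_1),\dots,\alpha P(A_k))$ for every finite measurable partition of $\Xi$. Let $\alpha_0>0$, $\alpha_\ell>0$ for all $\ell$, and let $H\in\mathcal P_\Xi$ be diffuse. Consider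 the Bayesian model with hierarchical Dirichlet process prior $$p_0\sim\mathrm{DP}(\alpha_0,H),\qquad p_\ell\mid p_0\overset{\text{ind}}{\sim}\mathrm{DP}(\alpha_\ell,p_0),\qquad \xi_{\ell j}\mid(p_1,\dots,p_S)\overset{\text{ind}}{\sim}p_\ell ,$$ and let $Q^s_{\boldsymbol\xi^N}$ be a version of the (regular) conditional distribution of $p_s$ given $\boldsymbol\xi^N$ in this model. Assume that either $p^\star_\ell\ll H$ for all $\ell$ (and the version is arbitrary), or else that at every sample without ties the version is the usual one, namely $$p_0\sim\mathrm{DP}\Big(\alpha_0+N,\tfrac{\alpha_0H+\sum_{\ell,j}\delta_{\xi_{\ell j}}}{\alpha_0+N}\Big),\qquad p_s\mid p_0\sim\mathrm{DP}\Big(\alpha_s+N_s,\tfrac{\alpha_sp_0+\sum_j\delta_{\xi_{sj}}}{\alpha_s+N_s}\Big).$$ Let $\Theta$ be a set, $0<K<\infty$, and $h:\Theta\times\Xi\to[0,K]$ with $h(\theta,\cdot)$ measurable for each $\theta$; put $\mathcal R_p(\theta)=\int h(\theta,\xi)\,p(\mathrm d\xi)$. Let $\phi$ be continuous, strictly increasing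 and convex on $[0,K]$ and twice continuously differentiable on $(0,K)$, with $F_\phi:=\sup_{t\in(0,K)}\phi'(t)$ and $S_\phi:=\sup_{t\in(0,K)}\phi''(t)<\infty$ (these assumptions imply $0<F_\phi<\infty$). Put $$V^s_{\boldsymbol\xi^N}(\theta)=\int_{\mathcal P_\Xi}\phi(\mathcal R_p(\theta))\,Q^s_{\boldsymbol\xi^N}(\mathrm dp).$$ Let $\theta^s_N$ be a ($\Theta$-valued, data-dependent) point which almost surely minimizes $V^s_{\boldsymbol\xi^N}$ over $\Theta$, and let $\theta^s_\star\in\arg\min_{\theta\in\Theta}\mathcal R_{p^\star_s}(\theta)$. **Theorem.** For all $\delta>0$, $$\mathbb P\big[\phi(\mathcal R_{p_s^\star}(\theta_N^s))-\phi(\mathcal R_{p_s^\star}(\theta_\star^s))\le\delta\big]\ \ge\ \mathbb P\Bigg[\sup_{\theta\in\Theta}\big|\mathcal R_{p_{\boldsymbol\xi_s}}(\theta)-\mathcal R_{p_s^\star}(\theta)\big|\le\frac{\alpha_s+N_s}{N_s}\Big(\frac{\delta}{2F_\phi}-\frac{\alpha_s}{\alpha_s+N_s}K-\frac{K^2}{2}\frac{S_\phi}{F_\phi}\Big)\Bigg].$$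 (If one of these events is not measurable, $\mathbb P$ denotes its outer probability.) -/

import Mathlib

open MeasureTheory ProbabilityTheory Set

section HDP

variable {Ξ : Type*} [MeasurableSpace Ξ]

/-- A product of measurable families of probability measures is a measurable family. -/
theorem measurable_measurePi {A ι : Type*} [MeasurableSpace A] [Fintype ι]
    {X : ι → Type*} [∀ i, MeasurableSpace (X i)] {μ : ∀ i, A → Measure (X i)}
    [∀ i a, IsProbabilityMeasure (μ i a)] (hμ : ∀ i, Measurable (μ i)) :
    Measurable fun a => Measure.pi fun i => μ i a := by
  refine Measurable.measure_of_isPiSystem_of_isProbabilityMeasure generateFrom_pi.symm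
    isPiSystem_pi ?_
  rintro _ ⟨B, hB, rfl⟩
  simp only [Measure.pi_pi]
  exact Finset.measurable_prod _ fun i _ =>
    (Measure.measurable_coe (hB i (mem_univ i))).comp (hμ i)

/-- The Dirichlet distribution with parameters `a i ≥ 0`, not all zero: the law of the vector
`G i / ∑ j, G j`, where the `G i` are independent, `G i` has the Gamma distribution with
shape `a i` and rate `1` if `a i > 0`, and `G i = 0` if `a i = 0`. -/
noncomputable def dirichletMeasure {k : ℕ} (a : Fin k → ℝ) : Measure (Fin k → ℝ) :=
  (Measure.pi fun i => if 0 < a i then gammaMeasure (a i) 1 else Measure.dirac 0).map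
    fun g i => g i / ∑ j, g j

/-- `D` is the law of a Dirichlet process with concentration `α` and centering probability
measure `P`: for every finite measurable partition `A` of `Ξ`, if `p` has law `D` then the vector
`(p (A 1), …, p (A k))` has the Dirichlet distribution with parameters `α * P (A i)`. -/
structure IsDirichletProcess (α : ℝ) (P : Measure Ξ) (D : Measure (ProbabilityMeasure Ξ)) :
    Prop where
  isProbabilityMeasure : IsProbabilityMeasure D
  map_partition : ∀ (k : ℕ) (A : Fin k → Set Ξ), (∀ i, MeasurableSet (A i)) →
    Pairwise (fun i j => Disjoint (A i) (A j)) → (⋃ i, A i) = univ →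
    D.map (fun (p : ProbabilityMeasure Ξ) i => (p : Measure Ξ).real (A i)) = dirichletMeasure fun i => α * P.real (A i)

/-- `Q` is the law of `(p 1, …, p S)` under the hierarchical Dirichlet process: `p₀` is a
Dirichlet process with parameters `(α₀, H)` and, given `p₀`, the `p ℓ` are independent Dirichlet
processes with parameters `(α ℓ, p₀)`. -/
def IsHDP {S : ℕ} (α₀ : ℝ) (α : Fin S → ℝ) (H : Measure Ξ)
    (Q : Measure (Fin S → ProbabilityMeasure Ξ)) : Prop :=
  ∃ (D₀ : Measure (ProbabilityMeasure Ξ))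
    (κ : Fin S → Kernel (ProbabilityMeasure Ξ) (ProbabilityMeasure Ξ)),
    IsDirichletProcess α₀ H D₀ ∧
    (∀ ℓ (p₀ : ProbabilityMeasure Ξ), IsDirichletProcess (α ℓ) (p₀ : Measure Ξ) (κ ℓ p₀)) ∧
    Q = D₀.bind fun p₀ => Measure.pi fun ℓ => κ ℓ p₀

/-- Grouped samples: `x ℓ j` is the `j`-th observation of group `ℓ`. -/
abbrev GroupedData (Ξ : Type*) {S : ℕ} (N : Fin S → ℕ) : Type _ := (ℓ : Fin S) → Fin (N ℓ) → Ξ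

/-- The conditional law of the grouped sample given `(p 1, …, p S)`: all observations are
independent and those of group `ℓ` have law `p ℓ`. -/
noncomputable def samplingKernel {S : ℕ} (N : Fin S → ℕ) :
    Kernel (Fin S → ProbabilityMeasure Ξ) (GroupedData Ξ N) where
  toFun p := Measure.pi fun ℓ => Measure.pi fun _ : Fin (N ℓ) => (p ℓ : Measure Ξ)
  measurable' := measurable_measurePi fun ℓ => measurable_measurePi fun _ =>
    measurable_subtype_coe.comp (measurable_pi_apply ℓ)

instance {S : ℕ} (N : Fin S → ℕ) : IsMarkovKernel (samplingKernel (Ξ := Ξ) N) where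
  isProbabilityMeasure p := by
    change IsProbabilityMeasure
      (Measure.pi fun ℓ => Measure.pi fun _ : Fin (N ℓ) => (p ℓ : Measure Ξ))
    infer_instance

/-- `post` is a version of the posterior of group `s`, that is, of the conditional distribution of
`p s` given the grouped sample, in the Bayesian model where `(p 1, …, p S)` has the hierarchical
Dirichlet process prior and, given `(p 1, …, p S)`, the sample is drawn from `samplingKernel`. -/
def IsHDPPosterior {S : ℕ} (N : Fin S → ℕ) (α₀ : ℝ) (α : Fin S → ℝ) (H : Measure Ξ) (s : Fin S)
    (post : Kernel (GroupedData Ξ N) (ProbabilityMeasure Ξ)) : Prop :=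
  ∃ Q : Measure (Fin S → ProbabilityMeasure Ξ), IsHDP α₀ α H Q ∧
    HasCondDistrib (fun z : (Fin S → ProbabilityMeasure Ξ) × GroupedData Ξ N => z.1 s) Prod.snd
      post (Q ⊗ₘ samplingKernel N)

/-- The pooled sample, indexed by pairs (group, index in the group). -/
def pooled {S : ℕ} {N : Fin S → ℕ} (x : GroupedData Ξ N) : (Σ ℓ : Fin S, Fin (N ℓ)) → Ξ :=
  fun i => x i.1 i.2

/-- The updated centering measure `(α P + ∑ i, δ_{y i}) / (α + n)` after observing `y` of
size `n`. -/
noncomputable def updatedBase {ι : Type*} [Fintype ι] (α : ℝ) (P : Measure Ξ) (y : ι → Ξ) :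
    Measure Ξ :=
  ENNReal.ofReal (1 / (α + Fintype.card ι)) •
    (ENNReal.ofReal α • P + ∑ i, Measure.dirac (y i))

/-- `q` is the two-stage law of `p s` at the sample `x`: draw `p₀` from the Dirichlet process
with concentration `α₀ + ∑ N` and centering measure updated by the pooled sample; then draw `p s`
from the Dirichlet process with concentration `α s + N s` and centering measure `p₀` updated by the
sample of group `s`. -/
def IsTwoStageLaw {S : ℕ} {N : Fin S → ℕ} (α₀ : ℝ) (α : Fin S → ℝ) (H : Measure Ξ) (s : Fin S)
    (x : GroupedData Ξ N) (q : Measure (ProbabilityMeasure Ξ)) : Prop :=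
  ∃ (D₀ : Measure (ProbabilityMeasure Ξ))
    (κ : Kernel (ProbabilityMeasure Ξ) (ProbabilityMeasure Ξ)),
    IsDirichletProcess (α₀ + ((∑ ℓ, N ℓ : ℕ) : ℝ)) (updatedBase α₀ H (pooled x)) D₀ ∧
    (∀ p₀ : ProbabilityMeasure Ξ,
      IsDirichletProcess (α s + (N s : ℝ)) (updatedBase (α s) (p₀ : Measure Ξ) (x s)) (κ p₀)) ∧
    q = D₀.bind κ

/-- The risk of `θ` under `p`: the expectation of the loss `h θ` under `p`. -/
noncomputable def risk {Θ : Type*} (h : Θ → Ξ → ℝ) (p : Measure Ξ) (θ : Θ) : ℝ :=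
  ∫ x, h θ x ∂p

/-- The empirical distribution of a finite sample. -/
noncomputable def empiricalMeasure {n : ℕ} (y : Fin n → Ξ) : Measure Ξ :=
  ENNReal.ofReal (1 / (n : ℝ)) • ∑ i, Measure.dirac (y i)

/-- The smooth ambiguity-averse criterion: the average of `φ (risk h p θ)` over `p` with law `q`. -/
noncomputable def criterion {Θ : Type*} (φ : ℝ → ℝ) (h : Θ → Ξ → ℝ)
    (q : Measure (ProbabilityMeasure Ξ)) (θ : Θ) : ℝ :=
  ∫ p, φ (risk h (p : Measure Ξ) θ) ∂q

/-- `F_φ`, the supremum of `φ'` over `(0, K)`. -/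
noncomputable def supDeriv (φ : ℝ → ℝ) (K : ℝ) : ℝ := sSup (deriv φ '' Ioo 0 K)

/-- `S_φ`, the supremum of `φ''` over `(0, K)`. -/
noncomputable def supDeriv2 (φ : ℝ → ℝ) (K : ℝ) : ℝ := sSup (deriv (deriv φ) '' Ioo 0 K)

end HDP

/-! Everything goes through the posterior mean `m` of `p s`. The claim about it is that each
observation of group `s` is an atom of `m` of mass at least `1 / (α s + N s)`. Diffuseness and
independence exclude ties almost surely, so these atoms add up and `m` dominates the fraction `N s /
(α s + N s)` of the empirical measure. Losses lie in `[0, K]`, so the risk under `m` is uniformly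
close to the true risk on the event of the right-hand side. Jensen's inequality and a reverse Jensen
bound with error `K ^ 2 / 2 * S_φ` put the criterion close to `φ` of the risk under `m`, and `φ` is
`F_φ`-Lipschitz; comparing the minimizer with `θstar` then concludes.

For the two-stage version the atoms can be read off, since a Dirichlet process has its centering
measure as mean (`IsTwoStageLaw.one_le_mul_lintegral_singleton`). For an arbitrary version they come
from the Pólya urn rule: given the sample, a new observation repeats a given old one with
probability at least `1 / (α s + N s)`. This holds conditionally on `p₀` with a constant free of
`p₀`, hence after mixing, and disintegration gives the atoms almost surely under the Bayesian
marginal law (`IsHDP.ae_one_le_mul_lintegral_singleton`). It transfers to the true law because the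
urn rule, used at both levels of the hierarchy, shows that the marginal law dominates the product of
copies of `H` (`IsHDP.pi_absolutelyContinuous`).

The urn rule itself is derived from the moments of the finite-dimensional Dirichlet distributions.
-/

/-! ### Gamma integrals and the moments of Dirichlet distributions. -/

theorem lintegral_pi_prod {ι : Type*} [Fintype ι] {X : ι → Type*} [∀ i, MeasurableSpace (X i)]
    (μ : ∀ i, Measure (X i)) [∀ i, IsProbabilityMeasure (μ i)] {f : ∀ i, X i → ENNReal}
    (hf : ∀ i, Measurable (f i)) :
    ∫⁻ x, ∏ i, f i (x i) ∂Measure.pi μ = ∏ i, ∫⁻ y, f i y ∂μ i := by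
  refine (lintegral_prod_eq_prod_lintegral_of_indepFun Finset.univ
    (fun i (x : ∀ i, X i) => f i (x i))
    (iIndepFun_pi fun i => (hf i).aemeasurable)
    fun i => (hf i).comp (measurable_pi_apply i)).trans ?_
  refine Finset.prod_congr rfl fun i _ => ?_
  exact (measurePreserving_eval μ i).lintegral_comp (hf i)

/-- The rising factorial `a (a + 1) ⋯ (a + m - 1)` of a real number. -/
noncomputable def risingFactorial (a : ℝ) (m : ℕ) : ℝ := ∏ i ∈ Finset.range m, (a + i)

theorem risingFactorial_succ (a : ℝ) (m : ℕ) :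
    risingFactorial a (m + 1) = risingFactorial a m * (a + m) := Finset.prod_range_succ _ _

theorem risingFactorial_nonneg {a : ℝ} (ha : 0 ≤ a) (m : ℕ) : 0 ≤ risingFactorial a m :=
  Finset.prod_nonneg fun _ _ => by positivity

theorem Real.Gamma_add_natCast_eq_risingFactorial_mul {a : ℝ} (ha : 0 < a) (m : ℕ) :
    Real.Gamma (a + m) = risingFactorial a m * Real.Gamma a := by
  induction m with
  | zero => simp [risingFactorial]
  | succ m ih =>
    have : a + ((m + 1 : ℕ) : ℝ) = (a + m) + 1 := by push_cast; ring
    rw [this, Real.Gamma_add_one (by positivity), ih, risingFactorial_succ]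
    ring

/-- Tilting the density by `g ^ m * exp (-(t * g))` gives a multiple of the Gamma density of shape
`a + m` and rate `1 + t`, whose total mass is `1`. -/
theorem lintegral_pow_mul_exp_gammaMeasure {a t : ℝ} (ha : 0 < a) (ht : 0 < t) (m : ℕ) :
    ∫⁻ g, ENNReal.ofReal g ^ m * ENNReal.ofReal (Real.exp (-(t * g))) ∂gammaMeasure a 1 =
      ENNReal.ofReal (risingFactorial a m * (1 + t) ^ (-(a + m))) := by
  have key : ∀ᵐ g : ℝ, gammaPDF a 1 g *
      (ENNReal.ofReal g ^ m * ENNReal.ofReal (Real.exp (-(t * g)))) =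
      ENNReal.ofReal (risingFactorial a m * (1 + t) ^ (-(a + m))) * gammaPDF (a + m) (1 + t) g := by
    filter_upwards [Measure.ae_ne volume (0 : ℝ)] with g hg
    rcases lt_or_gt_of_ne hg with hg | hg
    · simp [gammaPDF_of_neg hg]
    rw [gammaPDF_of_nonneg hg.le, gammaPDF_of_nonneg hg.le, ← ENNReal.ofReal_pow hg.le,
      ← ENNReal.ofReal_mul (by positivity), ← ENNReal.ofReal_mul (by positivity),
      ← ENNReal.ofReal_mul (mul_nonneg (risingFactorial_nonneg ha.le _) (by positivity)),
      Real.Gamma_add_natCast_eq_risingFactorial_mul ha, Real.rpow_neg (by positivity)]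
    congr 1
    have h1 : (1 + t) ^ (a + m) ≠ 0 := by positivity
    have h2 : risingFactorial a m ≠ 0 := by
      refine Finset.prod_ne_zero_iff.2 fun i _ => ?_
      positivity
    have h3 : Real.Gamma a ≠ 0 := (Real.Gamma_pos_of_pos ha).ne'
    have h4 : g ^ (a + m - 1) = g ^ (a - 1) * g ^ m := by
      rw [← Real.rpow_natCast, ← Real.rpow_add hg]; ring_nf
    have h5 : Real.exp (-((1 + t) * g)) = Real.exp (-(1 * g)) * Real.exp (-(t * g)) := by
      rw [← Real.exp_add]; ring_nf
    rw [h4, h5, Real.one_rpow]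
    field_simp
  rw [gammaMeasure, lintegral_withDensity_eq_lintegral_mul _ (by fun_prop [gammaPDF]) (by fun_prop)]
  simp only [Pi.mul_apply]
  rw [lintegral_congr_ae key, lintegral_const_mul _ (by fun_prop [gammaPDF]),
    lintegral_gammaPDF_eq_one (by positivity) (by positivity), mul_one]

/-- The gamma distribution with rate `1`, degenerating to the Dirac mass at `0` if the shape
vanishes. -/
noncomputable def gammaOrZero (a : ℝ) : Measure ℝ :=
  if 0 < a then gammaMeasure a 1 else Measure.dirac 0

instance (a : ℝ) : IsProbabilityMeasure (gammaOrZero a) := by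
  unfold gammaOrZero
  split_ifs with h
  · exact isProbabilityMeasure_gammaMeasure h one_pos
  · infer_instance

theorem ae_nonneg_gammaOrZero (a : ℝ) : ∀ᵐ g ∂gammaOrZero a, 0 ≤ g := by
  unfold gammaOrZero
  split_ifs with h
  · rw [gammaMeasure, ae_withDensity_iff (by fun_prop [gammaPDF])]
    refine Filter.Eventually.of_forall fun g hg => ?_
    by_contra hneg
    exact hg (gammaPDF_of_neg (not_le.1 hneg))
  · simp [ae_dirac_eq]

/-- The formula survives a vanishing shape: at `a = 0` both sides are `1` if `m = 0`, and `0`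
otherwise because the rising factorial has a factor `0`. -/
theorem lintegral_pow_mul_exp_gammaOrZero {a t : ℝ} (ha : 0 ≤ a) (ht : 0 < t) (m : ℕ) :
    ∫⁻ g, ENNReal.ofReal g ^ m * ENNReal.ofReal (Real.exp (-(t * g))) ∂gammaOrZero a =
      ENNReal.ofReal (risingFactorial a m * (1 + t) ^ (-(a + m))) := by
  unfold gammaOrZero
  split_ifs with h
  · exact lintegral_pow_mul_exp_gammaMeasure h ht m
  · obtain rfl : a = 0 := le_antisymm (not_lt.1 h) ha
    rw [lintegral_dirac]
    cases m with
    | zero => simp [risingFactorial]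
    | succ m => simp [risingFactorial, Finset.prod_range_succ']

/-- The Gamma density of shape `n + 1` and rate `r` has mass `1`. This turns a power of the
normalizing sum into a mixture of exponentials, which factor over independent coordinates. -/
theorem ofReal_inv_pow_eq_lintegral {r : ℝ} (hr : 0 < r) (n : ℕ) :
    ENNReal.ofReal (r⁻¹ ^ (n + 1)) = ENNReal.ofReal ((n.factorial : ℝ)⁻¹) *
      ∫⁻ t in Ioi (0 : ℝ), ENNReal.ofReal (t ^ n) * ENNReal.ofReal (Real.exp (-(t * r))) := by
  have hpdf : gammaPDF (n + 1) r =ᵐ[volume] (Ioi (0 : ℝ)).indicator fun t =>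
      ENNReal.ofReal (r ^ (n + 1) * (n.factorial : ℝ)⁻¹) *
        (ENNReal.ofReal (t ^ n) * ENNReal.ofReal (Real.exp (-(t * r)))) := by
    filter_upwards [Measure.ae_ne volume (0 : ℝ)] with t ht
    rcases lt_or_gt_of_ne ht with ht | ht
    · rw [gammaPDF_of_neg ht, indicator_of_notMem (by simp [ht.le])]
    · rw [indicator_of_mem (by simpa using ht), gammaPDF_of_nonneg ht.le,
        ← ENNReal.ofReal_mul (by positivity), ← ENNReal.ofReal_mul (by positivity),
        Real.Gamma_nat_eq_factorial, add_sub_cancel_right, Real.rpow_natCast, mul_comm t r]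
      norm_cast
      rw [div_eq_mul_inv, mul_assoc]
  have hone := lintegral_gammaPDF_eq_one (a := n + 1) (r := r) (by positivity) hr
  rw [lintegral_congr_ae hpdf, lintegral_indicator measurableSet_Ioi,
    lintegral_const_mul _ (by fun_prop), ENNReal.ofReal_mul (by positivity), mul_assoc] at hone
  rw [← mul_one (ENNReal.ofReal (r⁻¹ ^ (n + 1))), ← hone, ← mul_assoc,
    ← ENNReal.ofReal_mul (by positivity), ← mul_pow, inv_mul_cancel₀ hr.ne', one_pow]
  simp

/-- The normalizing constant of the moments of degree `n + 1` of the Dirichlet distributions with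
total mass `A`. -/
noncomputable def dirichletMomentConst (A : ℝ) (n : ℕ) : ENNReal :=
  ENNReal.ofReal ((n.factorial : ℝ)⁻¹) * ∫⁻ t in Ioi (0 : ℝ),
    ENNReal.ofReal (t ^ n) * ENNReal.ofReal ((1 + t) ^ (-(A + (n + 1))))

/-- Once the denominator `(∑ j, G j) ^ (n + 1)` is written as an exponential mixture, independence
splits the integral. The powers of `1 + t` combine into one depending only on the total mass and the
degree, so only the rising factorials see the individual parameters. -/
theorem lintegral_prod_pow_dirichletMeasure {k : ℕ} {a : Fin k → ℝ} (ha : ∀ i, 0 ≤ a i)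
    {m : Fin k → ℕ} {n : ℕ} (hm : ∑ i, m i = n + 1) :
    ∫⁻ x, ∏ i, ENNReal.ofReal (x i) ^ m i ∂dirichletMeasure a =
      dirichletMomentConst (∑ i, a i) n * ∏ i, ENNReal.ofReal (risingFactorial (a i) (m i)) := by
  have hdir : dirichletMeasure a =
    (Measure.pi fun i => gammaOrZero (a i)).map fun g i => g i / ∑ j, g j := rfl
  have hnonneg : ∀ᵐ g ∂Measure.pi fun i => gammaOrZero (a i), ∀ i, 0 ≤ g i :=
    ae_all_iff.2 fun i => (Measure.tendsto_eval_ae_ae (i := i)).eventually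
      (ae_nonneg_gammaOrZero (a i))
  have key : ∀ᵐ g ∂Measure.pi fun i => gammaOrZero (a i),
      ∏ i, ENNReal.ofReal (g i / ∑ j, g j) ^ m i =
        ENNReal.ofReal ((n.factorial : ℝ)⁻¹) * ∫⁻ t in Ioi (0 : ℝ), ENNReal.ofReal (t ^ n) *
          ∏ i, (ENNReal.ofReal (g i) ^ m i * ENNReal.ofReal (Real.exp (-(t * g i)))) := by
    filter_upwards [hnonneg] with g hg
    have hsum : 0 ≤ ∑ j, g j := Finset.sum_nonneg fun j _ => hg j
    have hexp : ∀ t, ∏ i, (ENNReal.ofReal (g i) ^ m i * ENNReal.ofReal (Real.exp (-(t * g i)))) =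
        (∏ i, ENNReal.ofReal (g i) ^ m i) * ENNReal.ofReal (Real.exp (-(t * ∑ j, g j))) := by
      intro t
      rw [Finset.prod_mul_distrib, ← ENNReal.ofReal_prod_of_nonneg fun _ _ => by positivity,
        ← Real.exp_sum, Finset.sum_neg_distrib, Finset.mul_sum]
    simp_rw [hexp]
    -- When the sum vanishes the quotients are `0` by the convention `x / 0 = 0`; the degree is
    -- positive, so both sides are `0`.
    rcases hsum.eq_or_lt with h0 | hpos
    · have hz : ∀ i, g i = 0 := by
        simpa using (Finset.sum_eq_zero_iff_of_nonneg fun j _ => hg j).1 h0.symm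
      obtain ⟨i, hi⟩ : ∃ i, m i ≠ 0 := by
        by_contra! hcon
        simp [hcon] at hm
      have hzero : ∏ i, ENNReal.ofReal (g i) ^ m i = 0 :=
        Finset.prod_eq_zero (Finset.mem_univ i) (by simp [hz, hi])
      rw [hzero, Finset.prod_eq_zero (Finset.mem_univ i) (by simp [hz, hi])]
      simp
    · have hdiv : ∏ i, ENNReal.ofReal (g i / ∑ j, g j) ^ m i =
          (∏ i, ENNReal.ofReal (g i) ^ m i) * ENNReal.ofReal ((∑ j, g j)⁻¹ ^ (n + 1)) := by
        simp_rw [div_eq_mul_inv, ENNReal.ofReal_mul (hg _), mul_pow, Finset.prod_mul_distrib]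
        rw [Finset.prod_pow_eq_pow_sum, hm, ENNReal.ofReal_pow (by positivity)]
      rw [hdiv, ofReal_inv_pow_eq_lintegral hpos, mul_left_comm,
        ← lintegral_const_mul _ (by fun_prop)]
      congr 1
      refine lintegral_congr fun t => ?_
      ring
  rw [hdir, lintegral_map (by fun_prop) (by fun_prop), lintegral_congr_ae key,
    lintegral_const_mul _ (by fun_prop), lintegral_lintegral_swap (by fun_prop),
    dirichletMomentConst, mul_assoc, ← lintegral_mul_const _ (by fun_prop)]
  congr 1
  refine setLIntegral_congr_fun measurableSet_Ioi fun t ht => ?_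
  have ht : 0 < t := ht
  rw [lintegral_const_mul _ (by fun_prop), mul_assoc]
  congr 1
  rw [lintegral_pi_prod (fun i => gammaOrZero (a i)) (f := fun i g =>
    ENNReal.ofReal g ^ m i * ENNReal.ofReal (Real.exp (-(t * g)))) (fun i => by fun_prop)]
  simp_rw [lintegral_pow_mul_exp_gammaOrZero (ha _) ht]
  simp_rw [fun i => ENNReal.ofReal_mul (q := (1 + t) ^ (-(a i + m i)))
    (risingFactorial_nonneg (ha i) (m i))]
  rw [Finset.prod_mul_distrib, mul_comm, ← ENNReal.ofReal_prod_of_nonneg (fun _ _ => by positivity),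
    ← Real.rpow_sum_of_pos (by positivity), Finset.sum_neg_distrib, Finset.sum_add_distrib,
    ← Nat.cast_sum, hm]
  push_cast
  rfl

/-! ### The Pólya urn rule on rectangles. -/

section DirichletProcess

variable {Ξ : Type*} [MeasurableSpace Ξ]

theorem measurable_probabilityMeasure_coe_apply {A : Set Ξ} (hA : MeasurableSet A) :
    Measurable fun p : ProbabilityMeasure Ξ => (p : Measure Ξ) A :=
  (Measure.measurable_coe hA).comp measurable_subtype_coe

variable {α : ℝ} {P : Measure Ξ} [IsProbabilityMeasure P] {D : Measure (ProbabilityMeasure Ξ)}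

/-- A finite measurable partition is encoded by a measurable map `c`, with cells `c ⁻¹' {i}`; the
parameters then sum to `α`. -/
theorem IsDirichletProcess.lintegral_prod_pow (hD : IsDirichletProcess α P D) (hα : 0 < α) {k : ℕ}
    {c : Ξ → Fin k} (hc : Measurable c) {m : Fin k → ℕ} {n : ℕ} (hm : ∑ i, m i = n + 1) :
    ∫⁻ p, ∏ i, (p : Measure Ξ) (c ⁻¹' {i}) ^ m i ∂D = dirichletMomentConst α n *
      ∏ i, ENNReal.ofReal (risingFactorial (α * P.real (c ⁻¹' {i})) (m i)) := by
  have hmeas : ∀ i, MeasurableSet (c ⁻¹' {i}) := fun i => hc (measurableSet_singleton i)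
  have hsum : ∑ i, α * P.real (c ⁻¹' {i}) = α := by
    rw [← Finset.mul_sum, sum_measureReal_preimage_singleton _ fun i _ => hmeas i]
    simp
  have hmap := hD.map_partition k (fun i => c ⁻¹' {i}) hmeas
    (fun i j hij => Disjoint.preimage c (by simpa using hij)) (by ext; simp)
  have hmoment := lintegral_prod_pow_dirichletMeasure
    (a := fun i => α * P.real (c ⁻¹' {i})) (fun i => by positivity) hm
  rw [← hmap, lintegral_map (by fun_prop), hsum] at hmoment
  · rw [← hmoment]
    simp
  · exact measurable_pi_lambda _ fun i =>
      (measurable_probabilityMeasure_coe_apply (hmeas i)).ennreal_toReal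

/-- Raising the exponent of cell `j` by one multiplies the moment formula by `α P (A j) + m j`, with
a common factor `C`. Summing over `j` and using `∑ j, p (A j) = 1` expresses the unraised moment
through the same `C`, so the integral in `dirichletMomentConst` never has to be evaluated. -/
theorem IsDirichletProcess.lintegral_mul_prod_pow (hD : IsDirichletProcess α P D) (hα : 0 < α)
    {k : ℕ} {c : Ξ → Fin k} (hc : Measurable c) (m : Fin k → ℕ) (j : Fin k) :
    (ENNReal.ofReal α + (∑ i, m i : ℕ)) *
        ∫⁻ p, (p : Measure Ξ) (c ⁻¹' {j}) * ∏ i, (p : Measure Ξ) (c ⁻¹' {i}) ^ m i ∂D =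
      (ENNReal.ofReal α * P (c ⁻¹' {j}) + m j) *
        ∫⁻ p, ∏ i, (p : Measure Ξ) (c ⁻¹' {i}) ^ m i ∂D := by
  have hmeas : ∀ i, MeasurableSet (c ⁻¹' {i}) := fun i => hc (measurableSet_singleton i)
  -- The constant with index `∑ i, m i` is that of degree `∑ i, m i + 1`, the degree after raising
  -- one exponent.
  set C := dirichletMomentConst α (∑ i, m i) *
    ∏ i, ENNReal.ofReal (risingFactorial (α * P.real (c ⁻¹' {i})) (m i)) with hC
  have hsucc : ∀ j, ∫⁻ p, (p : Measure Ξ) (c ⁻¹' {j}) *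
      ∏ i, (p : Measure Ξ) (c ⁻¹' {i}) ^ m i ∂D =
        C * (ENNReal.ofReal α * P (c ⁻¹' {j}) + m j) := by
    intro j
    have hm : ∑ i, (m + Pi.single j 1 : Fin k → ℕ) i = (∑ i, m i) + 1 := by
      simp [Finset.sum_add_distrib]
    have hfac := hD.lintegral_prod_pow hα hc hm
    have h1 : ∀ f : Fin k → ENNReal, ∏ i, f i ^ (m + Pi.single j 1 : Fin k → ℕ) i =
        f j * ∏ i, f i ^ m i := by
      intro f
      simp_rw [Pi.add_apply, pow_add, Finset.prod_mul_distrib]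
      rw [mul_comm]
      congr 1
      rw [Finset.prod_eq_single j] <;> simp +contextual
    have h2 : ∀ i, ENNReal.ofReal
        (risingFactorial (α * P.real (c ⁻¹' {i})) ((m + Pi.single j 1 : Fin k → ℕ) i)) =
        ENNReal.ofReal (risingFactorial (α * P.real (c ⁻¹' {i})) (m i)) *
          (if i = j then ENNReal.ofReal α * P (c ⁻¹' {j}) + m j else 1) := by
      intro i
      split_ifs with hij
      · subst hij
        rw [Pi.add_apply, Pi.single_eq_same, risingFactorial_succ,
          ENNReal.ofReal_mul (risingFactorial_nonneg (by positivity) _),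
          ENNReal.ofReal_add (by positivity) (by positivity), ENNReal.ofReal_mul hα.le]
        simp
      · simp [hij]
    simp_rw [h1, h2, Finset.prod_mul_distrib] at hfac
    rw [hfac, Finset.prod_ite_eq' Finset.univ j, if_pos (Finset.mem_univ j), hC, mul_assoc]
  have htotal : ∫⁻ p, ∏ i, (p : Measure Ξ) (c ⁻¹' {i}) ^ m i ∂D =
      C * (ENNReal.ofReal α + (∑ i, m i : ℕ)) := by
    have hone : ∀ p : Measure Ξ, IsProbabilityMeasure p → ∑ j, p (c ⁻¹' {j}) = 1 := by
      intro p _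
      rw [sum_measure_preimage_singleton _ fun i _ => hmeas i]
      simp
    have hrw : ∀ p : ProbabilityMeasure Ξ, ∏ i, (p : Measure Ξ) (c ⁻¹' {i}) ^ m i =
        ∑ j, (p : Measure Ξ) (c ⁻¹' {j}) * ∏ i, (p : Measure Ξ) (c ⁻¹' {i}) ^ m i := by
      intro p
      rw [← Finset.sum_mul, hone p inferInstance, one_mul]
    rw [lintegral_congr hrw, lintegral_finsetSum _ fun j _ => ?_]
    · simp_rw [hsucc]
      rw [← Finset.mul_sum, Finset.sum_add_distrib, ← Finset.mul_sum, hone P inferInstance,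
        mul_one, Nat.cast_sum]
    · exact (measurable_probabilityMeasure_coe_apply (hmeas j)).mul
        (Finset.measurable_prod _ fun i _ =>
          (measurable_probabilityMeasure_coe_apply (hmeas i)).pow_const _)
  rw [hsucc, htotal]
  ring

/-- Collecting the sample indices by cell turns the product into powers whose exponents are the cell
counts. -/
theorem IsDirichletProcess.lintegral_mul_prod_preimage_singleton (hD : IsDirichletProcess α P D)
    (hα : 0 < α) {k : ℕ} {c : Ξ → Fin k} (hc : Measurable c) {ι : Type*} [Fintype ι]
    (b : ι → Fin k) (j : Fin k) :
    (ENNReal.ofReal α + Fintype.card ι) *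
        ∫⁻ p, (p : Measure Ξ) (c ⁻¹' {j}) * ∏ l, (p : Measure Ξ) (c ⁻¹' {b l}) ∂D =
      (ENNReal.ofReal α * P (c ⁻¹' {j}) + ∑ l, if b l = j then 1 else 0) *
        ∫⁻ p, ∏ l, (p : Measure Ξ) (c ⁻¹' {b l}) ∂D := by
  have hprod : ∀ f : Fin k → ENNReal,
      ∏ l, f (b l) = ∏ i, f i ^ (Finset.univ.filter fun l => b l = i).card := by
    intro f
    rw [← Finset.prod_fiberwise (g := b)]
    refine Finset.prod_congr rfl fun i _ => ?_
    rw [Finset.prod_congr rfl fun l hl => by rw [(Finset.mem_filter.1 hl).2], Finset.prod_const]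
  have h := hD.lintegral_mul_prod_pow hα hc
    (fun i => (Finset.univ.filter fun l => b l = i).card) j
  rw [← Finset.card_eq_sum_card_fiberwise fun l _ => Finset.mem_univ (b l)] at h
  simp_rw [fun p : ProbabilityMeasure Ξ => hprod fun i => (p : Measure Ξ) (c ⁻¹' {i})]
  simpa using h

/-- The cells are indexed by membership patterns; patterns that do not occur give empty cells. -/
theorem exists_measurable_fin_preimage {ι : Type*} [Fintype ι] {B : ι → Set Ξ}
    (hB : ∀ i, MeasurableSet (B i)) :
    ∃ (k : ℕ) (c : Ξ → Fin k), Measurable c ∧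
      ∃ T : ι → Finset (Fin k), ∀ i, B i = c ⁻¹' (T i : Set (Fin k)) := by
  classical
  let e := Fintype.equivFin (ι → Prop)
  have hcode : Measurable fun (x : Ξ) (i : ι) => x ∈ B i :=
    measurable_pi_lambda _ fun i => (hB i).mem
  refine ⟨_, fun x => e fun i => x ∈ B i, (measurable_of_countable e).comp hcode,
    fun i => Finset.univ.filter fun j => e.symm j i, fun i => ?_⟩
  ext x
  simp

/-- The Pólya urn rule of the Dirichlet process on measurable rectangles. -/
theorem IsDirichletProcess.lintegral_mul_prod (hD : IsDirichletProcess α P D) (hα : 0 < α)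
    {ι : Type*} [Fintype ι] {A : Set Ξ} (hA : MeasurableSet A) {B : ι → Set Ξ}
    (hB : ∀ i, MeasurableSet (B i)) :
    (ENNReal.ofReal α + Fintype.card ι) *
        ∫⁻ p, (p : Measure Ξ) A * ∏ l, (p : Measure Ξ) (B l) ∂D =
      ENNReal.ofReal α * P A * ∫⁻ p, ∏ l, (p : Measure Ξ) (B l) ∂D +
        ∑ i, ∫⁻ p, (Measure.pi fun _ : ι => (p : Measure Ξ)) ({x | x i ∈ A} ∩ univ.pi B) ∂D := by
  classical
  -- Indexing by `Option ι` gives one partition refining `A` and all the `B i` at once; both sides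
  -- then expand into sums over cells.
  obtain ⟨k, c, hc, T, hT⟩ := exists_measurable_fin_preimage
    (B := fun o : Option ι => o.elim A B) (by rintro (_ | i) <;> simp [hA, hB])
  have hmeas : ∀ i, MeasurableSet (c ⁻¹' {i}) := fun i => hc (measurableSet_singleton i)
  have hAT : A = c ⁻¹' (T none : Set (Fin k)) := hT none
  have hBT : ∀ i, B i = c ⁻¹' (T (some i) : Set (Fin k)) := fun i => hT (some i)
  have hsum : ∀ (p : Measure Ξ) (U : Finset (Fin k)),
      p (c ⁻¹' (U : Set (Fin k))) = ∑ j ∈ U, p (c ⁻¹' {j}) :=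
    fun p U => (sum_measure_preimage_singleton U fun i _ => hmeas i).symm
  have hB_prod : ∀ (p : Measure Ξ), ∏ l, p (B l) =
      ∑ b ∈ Fintype.piFinset fun l => T (some l), ∏ l, p (c ⁻¹' {b l}) := by
    intro p
    simp_rw [hBT, hsum, Finset.prod_univ_sum]
  have hinter : ∀ (p : Measure Ξ) [IsProbabilityMeasure p] (i : ι),
      (Measure.pi fun _ : ι => p) ({x | x i ∈ A} ∩ univ.pi B) =
        ∑ b ∈ Fintype.piFinset fun l => T (some l),
          ∑ j ∈ T none, (if b i = j then 1 else 0) * ∏ l, p (c ⁻¹' {b l}) := by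
    intro p _ i
    have hset : {x : ι → Ξ | x i ∈ A} ∩ univ.pi B = univ.pi fun l =>
        c ⁻¹' ((T (some l)).filter fun j => l = i → j ∈ T none : Finset (Fin k)) := by
      ext x
      simp only [mem_inter_iff, mem_ofPred_eq, mem_univ_pi, hAT, hBT, mem_preimage,
        Finset.coe_filter, Finset.mem_coe]
      exact ⟨fun h l => ⟨h.2 l, fun hl => hl ▸ h.1⟩, fun h => ⟨(h i).2 rfl, fun l => (h l).1⟩⟩
    rw [hset, Measure.pi_pi]
    simp_rw [hsum, Finset.prod_univ_sum, ← Finset.sum_mul, Finset.sum_ite_eq, ite_mul, one_mul,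
      zero_mul]
    rw [← Finset.sum_filter]
    refine Finset.sum_congr ?_ fun _ _ => rfl
    ext b
    simp only [Fintype.mem_piFinset, Finset.mem_filter]
    exact ⟨fun h => ⟨fun l => (h l).1, (h i).2 rfl⟩, fun h l => ⟨h.1 l, fun hl => hl ▸ h.2⟩⟩
  have hmeasprod : ∀ b : ι → Fin k, Measurable fun p : ProbabilityMeasure Ξ =>
      ∏ l, (p : Measure Ξ) (c ⁻¹' {b l}) := fun b =>
    Finset.measurable_prod _ fun i _ => measurable_probabilityMeasure_coe_apply (hmeas (b i))
  have hmeasmul : ∀ (b : ι → Fin k) (j : Fin k), Measurable fun p : ProbabilityMeasure Ξ =>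
      (p : Measure Ξ) (c ⁻¹' {j}) * ∏ l, (p : Measure Ξ) (c ⁻¹' {b l}) := fun b j =>
    (measurable_probabilityMeasure_coe_apply (hmeas j)).mul (hmeasprod b)
  have hPA : P A = ∑ j ∈ T none, P (c ⁻¹' {j}) := by rw [hAT, hsum]
  have hl : ∫⁻ p, (p : Measure Ξ) A * ∏ l, (p : Measure Ξ) (B l) ∂D =
      ∑ b ∈ Fintype.piFinset fun l => T (some l), ∑ j ∈ T none,
        ∫⁻ p, (p : Measure Ξ) (c ⁻¹' {j}) * ∏ l, (p : Measure Ξ) (c ⁻¹' {b l}) ∂D := by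
    simp_rw [hB_prod, Finset.mul_sum, hAT, hsum, Finset.sum_mul]
    rw [lintegral_finsetSum _ fun b _ => Finset.measurable_sum _ fun j _ => hmeasmul b j]
    refine Finset.sum_congr rfl fun b _ => ?_
    rw [lintegral_finsetSum _ fun j _ => hmeasmul b j]
  have hr : ∫⁻ p, ∏ l, (p : Measure Ξ) (B l) ∂D =
      ∑ b ∈ Fintype.piFinset fun l => T (some l),
        ∫⁻ p, ∏ l, (p : Measure Ξ) (c ⁻¹' {b l}) ∂D := by
    simp_rw [hB_prod]
    rw [lintegral_finsetSum _ fun b _ => hmeasprod b]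
  have hi : ∀ i, ∫⁻ p, (Measure.pi fun _ : ι => (p : Measure Ξ))
      ({x | x i ∈ A} ∩ univ.pi B) ∂D =
      ∑ b ∈ Fintype.piFinset fun l => T (some l), ∑ j ∈ T none,
        (if b i = j then 1 else 0) * ∫⁻ p, ∏ l, (p : Measure Ξ) (c ⁻¹' {b l}) ∂D := by
    intro i
    simp_rw [hinter]
    rw [lintegral_finsetSum _ fun b _ => Finset.measurable_sum _ fun j _ =>
      (hmeasprod b).const_mul _]
    refine Finset.sum_congr rfl fun b _ => ?_
    rw [lintegral_finsetSum _ fun j _ => (hmeasprod b).const_mul _]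
    exact Finset.sum_congr rfl fun j _ => lintegral_const_mul _ (hmeasprod b)
  simp_rw [hl, hr, hi, Finset.mul_sum, hD.lintegral_mul_prod_preimage_singleton hα hc]
  rw [Finset.sum_comm (s := (Finset.univ : Finset ι)), ← Finset.sum_add_distrib]
  refine Finset.sum_congr rfl fun b _ => ?_
  rw [Finset.sum_comm, hPA, Finset.mul_sum, Finset.sum_mul, ← Finset.sum_add_distrib]
  refine Finset.sum_congr rfl fun j _ => ?_
  rw [add_mul, Finset.sum_mul]

end DirichletProcess

/-! ### Finite product measures: uniqueness, densities, absolute continuity. -/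

theorem MeasureTheory.Measure.ext_of_univ_pi {ι : Type*} [Fintype ι] {X : ι → Type*}
    [∀ i, MeasurableSpace (X i)] {μ ν : Measure (∀ i, X i)} [IsFiniteMeasure μ]
    (h : ∀ B : ∀ i, Set (X i), (∀ i, MeasurableSet (B i)) → μ (univ.pi B) = ν (univ.pi B)) :
    μ = ν := by
  refine ext_of_generate_finite _ generateFrom_pi.symm isPiSystem_pi ?_ ?_
  · rintro _ ⟨B, hB, rfl⟩
    exact h B fun i => hB i (mem_univ i)
  · simpa using h (fun _ => univ) fun _ => MeasurableSet.univ

theorem MeasureTheory.Measure.pi_withDensity {ι : Type*} [Fintype ι] {X : ι → Type*}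
    [∀ i, MeasurableSpace (X i)] (μ : ∀ i, Measure (X i)) [∀ i, IsProbabilityMeasure (μ i)]
    {f : ∀ i, X i → ENNReal} (hf : ∀ i, Measurable (f i))
    [∀ i, SigmaFinite ((μ i).withDensity (f i))] :
    Measure.pi (fun i => (μ i).withDensity (f i)) =
      (Measure.pi μ).withDensity fun x => ∏ i, f i (x i) := by
  refine Measure.pi_eq fun B hB => ?_
  rw [withDensity_apply _ (MeasurableSet.univ_pi hB),
    ← lintegral_indicator (MeasurableSet.univ_pi hB)]
  have : (univ.pi B).indicator (fun x => ∏ i, f i (x i)) =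
      fun x => ∏ i, (B i).indicator (f i) (x i) := by
    ext x
    by_cases hx : x ∈ univ.pi B
    · rw [indicator_of_mem hx]
      exact Finset.prod_congr rfl fun i _ => (indicator_of_mem (hx i (mem_univ i)) _).symm
    · rw [indicator_of_notMem hx]
      obtain ⟨i, hi⟩ : ∃ i, x i ∉ B i := by simpa using hx
      exact (Finset.prod_eq_zero (Finset.mem_univ i) (indicator_of_notMem hi _)).symm
  rw [this, lintegral_pi_prod μ fun i => (hf i).indicator (hB i)]
  refine Finset.prod_congr rfl fun i _ => ?_
  rw [lintegral_indicator (hB i), withDensity_apply _ (hB i)]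

theorem MeasureTheory.Measure.AbsolutelyContinuous.pi {ι : Type*} [Fintype ι] {X : ι → Type*}
    [∀ i, MeasurableSpace (X i)] {μ ν : ∀ i, Measure (X i)} [∀ i, IsProbabilityMeasure (μ i)]
    [∀ i, IsProbabilityMeasure (ν i)] (h : ∀ i, μ i ≪ ν i) : Measure.pi μ ≪ Measure.pi ν := by
  have hμ : μ = fun i => (ν i).withDensity ((μ i).rnDeriv (ν i)) :=
    funext fun i => (Measure.withDensity_rnDeriv_eq _ _ (h i)).symm
  have : ∀ i, SigmaFinite ((ν i).withDensity ((μ i).rnDeriv (ν i))) := fun i => by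
    rw [Measure.withDensity_rnDeriv_eq _ _ (h i)]
    infer_instance
  rw [hμ, Measure.pi_withDensity ν fun i => Measure.measurable_rnDeriv _ _]
  exact withDensity_absolutelyContinuous _ _

/-! ### Independent samples from a Dirichlet process. -/

section DirichletProcess

variable {Ξ : Type*} [MeasurableSpace Ξ]

/-- The tautological kernel from probability measures on `Ξ` to `Ξ`. -/
noncomputable def evalKernel (Ξ : Type*) [MeasurableSpace Ξ] :
    Kernel (ProbabilityMeasure Ξ) Ξ where
  toFun p := p
  measurable' := measurable_subtype_coe

instance : IsMarkovKernel (evalKernel Ξ) := ⟨fun p => p.2⟩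

/-- The law of a family of independent observations, as a function of their common law. -/
noncomputable def iidKernel (Ξ : Type*) [MeasurableSpace Ξ] (ι : Type*) [Fintype ι] :
    Kernel (ProbabilityMeasure Ξ) (ι → Ξ) where
  toFun p := Measure.pi fun _ => (p : Measure Ξ)
  measurable' := measurable_measurePi fun _ => measurable_subtype_coe

instance (ι : Type*) [Fintype ι] : IsMarkovKernel (iidKernel Ξ ι) :=
  ⟨fun p => inferInstanceAs (IsProbabilityMeasure (Measure.pi fun _ => (p : Measure Ξ)))⟩

theorem evalKernel_apply (p : ProbabilityMeasure Ξ) : evalKernel Ξ p = (p : Measure Ξ) := rfl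

theorem iidKernel_apply {ι : Type*} [Fintype ι] (p : ProbabilityMeasure Ξ) :
    iidKernel Ξ ι p = Measure.pi fun _ => (p : Measure Ξ) := rfl

variable {α : ℝ} {P : Measure Ξ} [IsProbabilityMeasure P] {D : Measure (ProbabilityMeasure Ξ)}

/-- For fixed `A`, both sides are measures in `E` (the left one reweights `D` by `p A`), the right
one is finite, and they agree on rectangles. -/
theorem IsDirichletProcess.lintegral_mul_iidKernel (hD : IsDirichletProcess α P D) (hα : 0 < α)
    {ι : Type*} [Fintype ι] {A : Set Ξ} (hA : MeasurableSet A) {E : Set (ι → Ξ)}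
    (hE : MeasurableSet E) :
    (ENNReal.ofReal α + Fintype.card ι) * ∫⁻ p, (p : Measure Ξ) A * iidKernel Ξ ι p E ∂D =
      ENNReal.ofReal α * P A * ∫⁻ p, iidKernel Ξ ι p E ∂D +
        ∑ i, ∫⁻ p, iidKernel Ξ ι p ({x | x i ∈ A} ∩ E) ∂D := by
  have := hD.isProbabilityMeasure
  have hpA := measurable_probabilityMeasure_coe_apply hA
  have hset : ∀ i : ι, MeasurableSet {x : ι → Ξ | x i ∈ A} := fun i => measurable_pi_apply i hA
  let ν₁ : Measure (ι → Ξ) := (ENNReal.ofReal α + Fintype.card ι) •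
    (D.withDensity fun p => (p : Measure Ξ) A).bind (iidKernel Ξ ι)
  let ν₂ : Measure (ι → Ξ) := (ENNReal.ofReal α * P A) • D.bind (iidKernel Ξ ι) +
    ∑ i, (D.bind (iidKernel Ξ ι)).restrict {x | x i ∈ A}
  have h₁ : ∀ E, MeasurableSet E → ν₁ E = (ENNReal.ofReal α + Fintype.card ι) *
      ∫⁻ p, (p : Measure Ξ) A * iidKernel Ξ ι p E ∂D := by
    intro E hE
    rw [Measure.smul_apply, Measure.bind_apply hE (iidKernel Ξ ι).aemeasurable,
      lintegral_withDensity_eq_lintegral_mul _ hpA ((iidKernel Ξ ι).measurable_coe hE)]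
    rfl
  have h₂ : ∀ E, MeasurableSet E → ν₂ E =
      ENNReal.ofReal α * P A * ∫⁻ p, iidKernel Ξ ι p E ∂D +
        ∑ i, ∫⁻ p, iidKernel Ξ ι p ({x | x i ∈ A} ∩ E) ∂D := by
    intro E hE
    simp only [ν₂, Measure.add_apply, Measure.smul_apply, Measure.finsetSum_apply, smul_eq_mul,
      Measure.restrict_apply hE, Measure.bind_apply hE (iidKernel Ξ ι).aemeasurable]
    congr 1
    refine Finset.sum_congr rfl fun i _ => ?_
    rw [inter_comm, Measure.bind_apply ((hset i).inter hE) (iidKernel Ξ ι).aemeasurable]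
  have hfin : IsFiniteMeasure ν₂ := by
    have h : ENNReal.ofReal α * P A ≠ ⊤ := by finiteness
    have := Measure.smul_finite (D.bind (iidKernel Ξ ι)) h
    infer_instance
  rw [← h₁ E hE, ← h₂ E hE]
  congr 1
  refine (Measure.ext_of_univ_pi fun B hB => ?_).symm
  rw [h₁ _ (MeasurableSet.univ_pi hB), h₂ _ (MeasurableSet.univ_pi hB)]
  simp_rw [iidKernel_apply, Measure.pi_pi]
  exact (hD.lintegral_mul_prod hα hA hB).symm

/-- In the urn rule a new observation is either fresh from `P` or a repetition; dropping the
repetitions leaves this inequality. -/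
theorem IsDirichletProcess.prod_bind_iidKernel_le (hD : IsDirichletProcess α P D) (hα : 0 < α)
    (ι : Type*) [Fintype ι] :
    ENNReal.ofReal α • P.prod (D.bind (iidKernel Ξ ι)) ≤
      (ENNReal.ofReal α + Fintype.card ι) • D.bind (evalKernel Ξ ×ₖ iidKernel Ξ ι) := by
  have := hD.isProbabilityMeasure
  have hfin : IsFiniteMeasure (ENNReal.ofReal α • P.prod (D.bind (iidKernel Ξ ι)) +
      ∑ i, (D.bind (iidKernel Ξ ι)).map fun x => (x i, x)) := by
    have := Measure.smul_finite (P.prod (D.bind (iidKernel Ξ ι))) (c := ENNReal.ofReal α)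
      (by finiteness)
    infer_instance
  have heq : ENNReal.ofReal α • P.prod (D.bind (iidKernel Ξ ι)) +
      ∑ i, (D.bind (iidKernel Ξ ι)).map (fun x => (x i, x)) =
      (ENNReal.ofReal α + Fintype.card ι) • D.bind (evalKernel Ξ ×ₖ iidKernel Ξ ι) := by
    refine Measure.ext_prod fun {A E} hA hE => ?_
    simp only [Measure.add_apply, Measure.smul_apply, Measure.finsetSum_apply, smul_eq_mul,
      Measure.prod_prod, Measure.bind_apply hE (iidKernel Ξ ι).aemeasurable,
      Measure.bind_apply (hA.prod hE) (evalKernel Ξ ×ₖ iidKernel Ξ ι).aemeasurable,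
      Kernel.prod_apply, evalKernel_apply]
    rw [hD.lintegral_mul_iidKernel hα hA hE, mul_assoc]
    congr 1
    refine Finset.sum_congr rfl fun i _ => ?_
    rw [Measure.map_apply (by fun_prop) (hA.prod hE), Measure.bind_apply _
      (iidKernel Ξ ι).aemeasurable]
    · rfl
    · exact (measurable_pi_apply i hA).inter hE
  rw [← heq]
  exact Measure.le_add_right le_rfl

/-- Induction on the urn: a null event for `n + 1` draws is null when the first coordinate is a
fresh draw from `P` independent of `n` draws from the urn, and the induction hypothesis replaces
those by `n` copies of `P`. -/
theorem IsDirichletProcess.pi_absolutelyContinuous_fin (hD : IsDirichletProcess α P D)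
    (hα : 0 < α) (n : ℕ) :
    Measure.pi (fun _ : Fin n => P) ≪ D.bind (iidKernel Ξ (Fin n)) := by
  have := hD.isProbabilityMeasure
  induction n with
  | zero =>
    have : Measure.pi (fun _ : Fin 0 => P) = D.bind (iidKernel Ξ (Fin 0)) := by
      refine Measure.ext_of_univ_pi fun B hB => ?_
      rw [Measure.bind_apply (MeasurableSet.univ_pi hB) (iidKernel Ξ (Fin 0)).aemeasurable]
      simp [iidKernel_apply]
    rw [this]
  | succ n ih =>
    refine Measure.AbsolutelyContinuous.mk fun E hE hE0 => ?_
    let e := MeasurableEquiv.piFinSuccAbove (fun _ : Fin (n + 1) => Ξ) 0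
    have hpres : ∀ p : Measure Ξ, IsProbabilityMeasure p →
        Measure.pi (fun _ : Fin (n + 1) => p) E =
          (p.prod (Measure.pi fun _ : Fin n => p)) (e.symm ⁻¹' E) := fun p _ =>
      (((measurePreserving_piFinSuccAbove (fun _ : Fin (n + 1) => p) 0).symm _).measure_preimage
        hE.nullMeasurableSet).symm
    have hT : MeasurableSet (e.symm ⁻¹' E) := e.symm.measurable hE
    have hle := hD.prod_bind_iidKernel_le hα (Fin n) (e.symm ⁻¹' E)
    have hzero : D.bind (evalKernel Ξ ×ₖ iidKernel Ξ (Fin n)) (e.symm ⁻¹' E) = 0 := by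
      rw [Measure.bind_apply hT (Kernel.aemeasurable _), ← hE0,
        Measure.bind_apply hE (Kernel.aemeasurable _)]
      refine lintegral_congr fun p => ?_
      rw [Kernel.prod_apply, iidKernel_apply, iidKernel_apply, evalKernel_apply,
        hpres p inferInstance]
    rw [Measure.smul_apply, Measure.smul_apply, hzero, smul_zero, nonpos_iff_eq_zero,
      smul_eq_mul, mul_eq_zero] at hle
    rw [hpres P inferInstance]
    exact Measure.AbsolutelyContinuous.rfl.prod ih (hle.resolve_left (by simpa using hα))

theorem IsDirichletProcess.pi_absolutelyContinuous (hD : IsDirichletProcess α P D)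
    (hα : 0 < α) (ι : Type*) [Fintype ι] :
    Measure.pi (fun _ : ι => P) ≪ D.bind (iidKernel Ξ ι) := by
  let e := Fintype.equivFin ι
  have hmap : ∀ p : Measure Ξ, IsProbabilityMeasure p →
      (Measure.pi fun _ : Fin (Fintype.card ι) => p).map
        (MeasurableEquiv.piCongrLeft (fun _ : ι => Ξ) e.symm) = Measure.pi fun _ : ι => p :=
    fun p _ => Measure.pi_map_piCongrLeft e.symm fun _ => p
  have hf := (MeasurableEquiv.piCongrLeft (fun _ : ι => Ξ) e.symm).measurable
  rw [← hmap P inferInstance]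
  have h := (hD.pi_absolutelyContinuous_fin hα (Fintype.card ι)).map hf
  convert h
  ext E hE
  rw [Measure.map_apply hf hE, Measure.bind_apply hE (Kernel.aemeasurable _),
    Measure.bind_apply (hf hE) (Kernel.aemeasurable _)]
  refine lintegral_congr fun p => ?_
  rw [iidKernel_apply, iidKernel_apply, ← hmap p inferInstance, Measure.map_apply hf hE]

/-- This is the urn rule with an empty sample. -/
theorem IsDirichletProcess.lintegral_apply (hD : IsDirichletProcess α P D) (hα : 0 < α)
    {A : Set Ξ} (hA : MeasurableSet A) : ∫⁻ p, (p : Measure Ξ) A ∂D = P A := by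
  have := hD.isProbabilityMeasure
  have h := hD.lintegral_mul_prod hα (ι := Empty) hA (B := Empty.elim) (by simp)
  simpa [ENNReal.mul_right_inj, hα] using h

end DirichletProcess

/-! ### Grouped samples with independent group laws, as is the case given `p₀`. -/

section GroupedSamples

variable {Ξ : Type*} [MeasurableSpace Ξ] {S : ℕ} {N : Fin S → ℕ}

theorem samplingKernel_apply (p : Fin S → ProbabilityMeasure Ξ) :
    samplingKernel N p = Measure.pi fun ℓ => iidKernel Ξ (Fin (N ℓ)) (p ℓ) := rfl

theorem lintegral_mul_samplingKernel_univ_pi (D : Fin S → Measure (ProbabilityMeasure Ξ))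
    [∀ ℓ, IsProbabilityMeasure (D ℓ)] (s : Fin S) {g : ProbabilityMeasure Ξ → ENNReal}
    (hg : Measurable g) {E : ∀ ℓ, Set (Fin (N ℓ) → Ξ)} (hE : ∀ ℓ, MeasurableSet (E ℓ)) :
    ∫⁻ p, g (p s) * samplingKernel N p (univ.pi E) ∂Measure.pi D =
      (∫⁻ p, g p * iidKernel Ξ (Fin (N s)) p (E s) ∂D s) *
        ∏ ℓ ∈ Finset.univ.erase s, ∫⁻ p, iidKernel Ξ (Fin (N ℓ)) p (E ℓ) ∂D ℓ := by
  let f : ∀ ℓ, ProbabilityMeasure Ξ → ENNReal := fun ℓ p =>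
    (if ℓ = s then g p else 1) * iidKernel Ξ (Fin (N ℓ)) p (E ℓ)
  have hf : ∀ ℓ, Measurable (f ℓ) := fun ℓ => by
    refine Measurable.mul ?_ ((iidKernel Ξ (Fin (N ℓ))).measurable_coe (hE ℓ))
    split_ifs
    · exact hg
    · exact measurable_const
  have hprod : ∀ p : Fin S → ProbabilityMeasure Ξ,
      g (p s) * samplingKernel N p (univ.pi E) = ∏ ℓ, f ℓ (p ℓ) := by
    intro p
    rw [samplingKernel_apply, Measure.pi_pi, Finset.prod_mul_distrib,
      Finset.prod_ite_eq' Finset.univ s, if_pos (Finset.mem_univ s)]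
  simp_rw [hprod]
  rw [lintegral_pi_prod D hf, ← Finset.mul_prod_erase _ _ (Finset.mem_univ s)]
  congr 1
  · simp [f]
  · refine Finset.prod_congr rfl fun ℓ hℓ => ?_
    simp [f, Finset.ne_of_mem_erase hℓ]

variable {α : ℝ} {P : Measure Ξ} [IsProbabilityMeasure P]
  {D : Fin S → Measure (ProbabilityMeasure Ξ)} [∀ ℓ, IsProbabilityMeasure (D ℓ)] {s : Fin S}

/-- On rectangles the other groups contribute the same factor to every term, so the urn rule of
group `s` alone suffices; uniqueness of measures extends it to all `E`. -/
theorem IsDirichletProcess.lintegral_mul_samplingKernel (hD : IsDirichletProcess α P (D s))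
    (hα : 0 < α) {A : Set Ξ} (hA : MeasurableSet A) {E : Set (GroupedData Ξ N)}
    (hE : MeasurableSet E) :
    (ENNReal.ofReal α + N s) *
        ∫⁻ p, (p s : Measure Ξ) A * samplingKernel N p E ∂Measure.pi D =
      ENNReal.ofReal α * P A * ∫⁻ p, samplingKernel N p E ∂Measure.pi D +
        ∑ i, ∫⁻ p, samplingKernel N p ({x | x s i ∈ A} ∩ E) ∂Measure.pi D := by
  have hpA : Measurable fun p : Fin S → ProbabilityMeasure Ξ => (p s : Measure Ξ) A :=
    (measurable_probabilityMeasure_coe_apply hA).comp (measurable_pi_apply s)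
  have hset : ∀ i, MeasurableSet {x : GroupedData Ξ N | x s i ∈ A} := fun i =>
    (measurable_pi_apply i).comp (measurable_pi_apply s) hA
  let ν₁ : Measure (GroupedData Ξ N) := (ENNReal.ofReal α + N s) •
    ((Measure.pi D).withDensity fun p => (p s : Measure Ξ) A).bind (samplingKernel N)
  let ν₂ : Measure (GroupedData Ξ N) :=
    (ENNReal.ofReal α * P A) • (Measure.pi D).bind (samplingKernel N) +
      ∑ i, ((Measure.pi D).bind (samplingKernel N)).restrict {x | x s i ∈ A}
  have h₁ : ∀ E, MeasurableSet E → ν₁ E = (ENNReal.ofReal α + N s) *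
      ∫⁻ p, (p s : Measure Ξ) A * samplingKernel N p E ∂Measure.pi D := by
    intro E hE
    rw [Measure.smul_apply, Measure.bind_apply hE (samplingKernel N).aemeasurable,
      lintegral_withDensity_eq_lintegral_mul _ hpA ((samplingKernel N).measurable_coe hE)]
    rfl
  have h₂ : ∀ E, MeasurableSet E → ν₂ E =
      ENNReal.ofReal α * P A * ∫⁻ p, samplingKernel N p E ∂Measure.pi D +
        ∑ i, ∫⁻ p, samplingKernel N p ({x | x s i ∈ A} ∩ E) ∂Measure.pi D := by
    intro E hE
    simp only [ν₂, Measure.add_apply, Measure.smul_apply, Measure.finsetSum_apply, smul_eq_mul,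
      Measure.restrict_apply hE, Measure.bind_apply hE (samplingKernel N).aemeasurable]
    congr 1
    refine Finset.sum_congr rfl fun i _ => ?_
    rw [inter_comm, Measure.bind_apply ((hset i).inter hE) (samplingKernel N).aemeasurable]
  have hfin : IsFiniteMeasure ν₂ := by
    have h : ENNReal.ofReal α * P A ≠ ⊤ := by finiteness
    have := Measure.smul_finite ((Measure.pi D).bind (samplingKernel (Ξ := Ξ) N)) h
    infer_instance
  rw [← h₁ E hE, ← h₂ E hE]
  congr 1
  refine (Measure.ext_of_univ_pi fun B hB => ?_).symm
  rw [h₁ _ (MeasurableSet.univ_pi hB), h₂ _ (MeasurableSet.univ_pi hB)]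
  have hset' : ∀ i, MeasurableSet {x : Fin (N s) → Ξ | x i ∈ A} := fun i =>
    measurable_pi_apply i hA
  have hL := lintegral_mul_samplingKernel_univ_pi D s
    (measurable_probabilityMeasure_coe_apply hA) hB
  have hR := lintegral_mul_samplingKernel_univ_pi D s (g := fun _ => 1) measurable_const hB
  simp only [one_mul] at hR
  have hI : ∀ i, ∫⁻ p, samplingKernel N p ({x | x s i ∈ A} ∩ univ.pi B) ∂Measure.pi D =
      (∫⁻ p, iidKernel Ξ (Fin (N s)) p ({x | x i ∈ A} ∩ B s) ∂D s) *
        ∏ ℓ ∈ Finset.univ.erase s, ∫⁻ p, iidKernel Ξ (Fin (N ℓ)) p (B ℓ) ∂D ℓ := by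
    intro i
    have hupd : {x : GroupedData Ξ N | x s i ∈ A} ∩ univ.pi B =
        univ.pi (Function.update B s ({x | x i ∈ A} ∩ B s)) := by
      ext x
      simp only [mem_inter_iff, mem_ofPred_eq, mem_univ_pi]
      refine ⟨fun h ℓ => ?_, fun h => ⟨?_, fun ℓ => ?_⟩⟩
      · rcases eq_or_ne ℓ s with rfl | hℓ
        · simpa using ⟨h.1, h.2 ℓ⟩
        · simpa [hℓ] using h.2 ℓ
      · have := h s
        simp only [Function.update_self] at this
        exact this.1
      · have := h ℓ
        rcases eq_or_ne ℓ s with rfl | hℓ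
        · simp only [Function.update_self] at this
          exact this.2
        · simpa [hℓ] using this
    have h := lintegral_mul_samplingKernel_univ_pi D s (g := fun _ => 1) measurable_const
      (E := Function.update B s ({x | x i ∈ A} ∩ B s)) (fun ℓ => by
        rcases eq_or_ne ℓ s with rfl | hℓ
        · simpa using (hset' i).inter (hB ℓ)
        · simpa [hℓ] using hB ℓ)
    simp only [one_mul, Function.update_self] at h
    rw [hupd, h]
    congr 1
    refine Finset.prod_congr rfl fun ℓ hℓ => ?_
    rw [Function.update_of_ne (Finset.ne_of_mem_erase hℓ)]
  have hrule := hD.lintegral_mul_iidKernel hα hA (hB s)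
  rw [Fintype.card_fin] at hrule
  simp_rw [hI]
  rw [hL, hR, ← mul_assoc (ENNReal.ofReal α + N s), hrule, add_mul, Finset.sum_mul, mul_assoc _ _
    (∏ ℓ ∈ _, _)]

/-- Given `p`, the joint law of a new observation of group `s` and of the grouped sample. -/
noncomputable def predictiveKernel (Ξ : Type*) [MeasurableSpace Ξ] {S : ℕ} (N : Fin S → ℕ)
    (s : Fin S) : Kernel (Fin S → ProbabilityMeasure Ξ) (Ξ × GroupedData Ξ N) :=
  (evalKernel Ξ).comap (fun p => p s) (measurable_pi_apply s) ×ₖ samplingKernel N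

theorem predictiveKernel_apply (p : Fin S → ProbabilityMeasure Ξ) :
    predictiveKernel Ξ N s p = (p s : Measure Ξ).prod (samplingKernel N p) := by
  rw [predictiveKernel, Kernel.prod_apply, Kernel.comap_apply, evalKernel_apply]

/-- The complementary use of the urn rule: the fresh draw and all repetitions but that of
observation `i` are dropped. -/
theorem IsDirichletProcess.map_bind_samplingKernel_le (hD : IsDirichletProcess α P (D s))
    (hα : 0 < α) (i : Fin (N s)) :
    ((Measure.pi D).bind (samplingKernel N)).map (fun x => (x s i, x)) ≤
      (ENNReal.ofReal α + N s) • (Measure.pi D).bind (predictiveKernel Ξ N s) := by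
  set M := (Measure.pi D).bind (samplingKernel (Ξ := Ξ) N) with hM
  have hmeas : ∀ i, Measurable fun x : GroupedData Ξ N => (x s i, x) := fun i => by fun_prop
  have hfin : IsFiniteMeasure (ENNReal.ofReal α • P.prod M +
      ∑ i, M.map fun x => (x s i, x)) := by
    have := Measure.smul_finite (P.prod M) (c := ENNReal.ofReal α) (by finiteness)
    infer_instance
  have heq : ENNReal.ofReal α • P.prod M + ∑ i, M.map (fun x => (x s i, x)) =
      (ENNReal.ofReal α + N s) • (Measure.pi D).bind (predictiveKernel Ξ N s) := by
    refine Measure.ext_prod fun {A E} hA hE => ?_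
    have hAE : MeasurableSet (A ×ˢ E) := hA.prod hE
    simp only [Measure.add_apply, Measure.smul_apply, Measure.finsetSum_apply, smul_eq_mul,
      Measure.prod_prod, Measure.bind_apply hAE (predictiveKernel Ξ N s).aemeasurable,
      predictiveKernel_apply]
    rw [hD.lintegral_mul_samplingKernel hα hA hE, mul_assoc,
      Measure.bind_apply hE (samplingKernel N).aemeasurable]
    congr 1
    refine Finset.sum_congr rfl fun i _ => ?_
    rw [Measure.map_apply (hmeas i) hAE,
      Measure.bind_apply (hmeas i hAE) (samplingKernel N).aemeasurable]
    rfl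
  rw [← heq]
  refine Measure.le_add_left ?_
  rw [← Finset.add_sum_erase _ _ (Finset.mem_univ i)]
  exact Measure.le_add_right le_rfl

theorem bind_samplingKernel_pi :
    (Measure.pi D).bind (samplingKernel (Ξ := Ξ) N) =
      Measure.pi fun ℓ => (D ℓ).bind (iidKernel Ξ (Fin (N ℓ))) := by
  refine (Measure.pi_eq fun B hB => ?_).symm
  rw [Measure.bind_apply (MeasurableSet.univ_pi hB) (samplingKernel N).aemeasurable]
  simp_rw [samplingKernel_apply, Measure.pi_pi]
  rw [lintegral_pi_prod D fun ℓ => (iidKernel Ξ (Fin (N ℓ))).measurable_coe (hB ℓ)]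
  exact Finset.prod_congr rfl fun ℓ _ => (Measure.bind_apply (hB ℓ) (Kernel.aemeasurable _)).symm

theorem map_sigmaCurry_pi {μ : ∀ ℓ : Fin S, Fin (N ℓ) → Measure Ξ}
    [∀ ℓ j, IsProbabilityMeasure (μ ℓ j)] :
    (Measure.pi fun i : Σ ℓ : Fin S, Fin (N ℓ) => μ i.1 i.2).map
      (fun y ℓ j => y ⟨ℓ, j⟩) = Measure.pi fun ℓ => Measure.pi (μ ℓ) := by
  have h := Measure.infinitePi_map_piCurry μ
  simp_rw [Measure.infinitePi_eq_pi] at h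
  exact h

end GroupedSamples

/-! ### The marginal law of the sample and the posterior atoms in the hierarchical model. -/

section HierarchicalDirichletProcess

variable {Ξ : Type*} [MeasurableSpace Ξ] {S : ℕ} {N : Fin S → ℕ} {α₀ : ℝ} {α : Fin S → ℝ}
  {H : Measure Ξ} {Q : Measure (Fin S → ProbabilityMeasure Ξ)}

theorem IsHDP.isProbabilityMeasure (hQ : IsHDP α₀ α H Q) : IsProbabilityMeasure Q := by
  obtain ⟨D₀, κ, hD₀, hκ, rfl⟩ := hQ
  have := hD₀.isProbabilityMeasure
  have hprob : ∀ ℓ p₀, IsProbabilityMeasure (κ ℓ p₀) := fun ℓ p₀ => (hκ ℓ p₀).isProbabilityMeasure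
  have hmeas := measurable_measurePi fun ℓ => (κ ℓ).measurable
  refine ⟨?_⟩
  rw [Measure.bind_apply MeasurableSet.univ hmeas.aemeasurable]
  simp

/-- The inequality holds for each `p₀` with a factor independent of `p₀`, so it passes to the
mixture. -/
theorem IsHDP.map_bind_samplingKernel_le (hQ : IsHDP α₀ α H Q) {s : Fin S} (hα : 0 < α s)
    (i : Fin (N s)) :
    (Q.bind (samplingKernel N)).map (fun x => (x s i, x)) ≤
      (ENNReal.ofReal (α s) + N s) • Q.bind (predictiveKernel Ξ N s) := by
  obtain ⟨D₀, κ, hD₀, hκ, rfl⟩ := hQ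
  have hprob : ∀ ℓ p₀, IsProbabilityMeasure (κ ℓ p₀) := fun ℓ p₀ => (hκ ℓ p₀).isProbabilityMeasure
  have hmeas := (measurable_measurePi fun ℓ => (κ ℓ).measurable).aemeasurable (μ := D₀)
  have hxm : Measurable fun x : GroupedData Ξ N => (x s i, x) := by fun_prop
  rw [Measure.bind_bind hmeas (Kernel.aemeasurable _),
    Measure.bind_bind hmeas (Kernel.aemeasurable _)]
  refine Measure.le_iff.2 fun T hT => ?_
  have hm : ∀ {Y : Type _} [MeasurableSpace Y] (η : Kernel (Fin S → ProbabilityMeasure Ξ) Y),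
      AEMeasurable (fun p₀ => (Measure.pi fun ℓ => κ ℓ p₀).bind η) D₀ := fun η =>
    ((Measure.measurable_bind' η.measurable).comp
      (measurable_measurePi fun ℓ => (κ ℓ).measurable)).aemeasurable
  rw [Measure.map_apply hxm hT, Measure.bind_apply (hxm hT) (hm _), Measure.smul_apply,
    Measure.bind_apply hT (hm _), smul_eq_mul, ← lintegral_const_mul' _ _ (by finiteness)]
  refine lintegral_mono fun p₀ => ?_
  have h := (hκ s p₀).map_bind_samplingKernel_le (D := fun ℓ => κ ℓ p₀) hα i T
  rwa [Measure.map_apply hxm hT] at h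

/-- Domination is used twice. For almost every `p₀`, an event null under the marginal law is null
for independent draws from `p₀`, by the group-level processes. The pooled sample is then an iid
sample from `p₀`, whose mixture over `D₀` dominates the product of copies of `H`. -/
theorem IsHDP.pi_absolutelyContinuous (hQ : IsHDP α₀ α H Q) [IsProbabilityMeasure H]
    (hα₀ : 0 < α₀) (hα : ∀ ℓ, 0 < α ℓ) :
    Measure.pi (fun ℓ => Measure.pi fun _ : Fin (N ℓ) => H) ≪ Q.bind (samplingKernel N) := by
  obtain ⟨D₀, κ, hD₀, hκ, rfl⟩ := hQ
  have := hD₀.isProbabilityMeasure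
  have hprob : ∀ ℓ p₀, IsProbabilityMeasure (κ ℓ p₀) := fun ℓ p₀ => (hκ ℓ p₀).isProbabilityMeasure
  have hmeas := measurable_measurePi fun ℓ => (κ ℓ).measurable
  rw [Measure.bind_bind hmeas.aemeasurable (Kernel.aemeasurable _)]
  refine Measure.AbsolutelyContinuous.mk fun E hE hE0 => ?_
  have hbind : Measurable fun p₀ => (Measure.pi fun ℓ => κ ℓ p₀).bind (samplingKernel (Ξ := Ξ) N) :=
    (Measure.measurable_bind' (samplingKernel N).measurable).comp hmeas
  rw [Measure.bind_apply hE hbind.aemeasurable] at hE0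
  replace hE0 := (lintegral_eq_zero_iff ((Measure.measurable_coe hE).comp hbind)).1 hE0
  have hcurry : Measurable fun (y : (Σ ℓ : Fin S, Fin (N ℓ)) → Ξ) ℓ j => y ⟨ℓ, j⟩ := by fun_prop
  have hpi : ∀ p : Measure Ξ, IsProbabilityMeasure p →
      Measure.pi (fun ℓ => Measure.pi fun _ : Fin (N ℓ) => p) E =
        Measure.pi (fun _ : Σ ℓ : Fin S, Fin (N ℓ) => p) ((fun y ℓ j => y ⟨ℓ, j⟩) ⁻¹' E) := by
    intro p _
    rw [← map_sigmaCurry_pi (μ := fun _ _ => p), Measure.map_apply hcurry hE]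
  rw [hpi H inferInstance]
  refine hD₀.pi_absolutelyContinuous hα₀ _ ?_
  rw [Measure.bind_apply (hcurry hE) (Kernel.aemeasurable _),
    lintegral_eq_zero_iff ((Kernel.measurable_coe _ (hcurry hE)))]
  filter_upwards [hE0] with p₀ hp₀
  rw [iidKernel_apply, ← hpi p₀ inferInstance]
  simp only [Function.comp_apply, bind_samplingKernel_pi] at hp₀
  exact Measure.AbsolutelyContinuous.pi
    (fun ℓ => (hκ ℓ p₀).pi_absolutelyContinuous (hα ℓ) (Fin (N ℓ))) hp₀

/-- The urn inequality is tested on the event that the new observation equals observation `i` and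
the sample lies in `E`. The left side becomes the marginal probability of `E`; the right side
disintegrates into the posterior mean mass at `x s i`, integrated over `E`. -/
theorem IsHDP.ae_one_le_mul_lintegral_singleton [StandardBorelSpace Ξ] {s : Fin S}
    {post : Kernel (GroupedData Ξ N) (ProbabilityMeasure Ξ)} [IsMarkovKernel post]
    (hQ : IsHDP α₀ α H Q)
    (hpost : HasCondDistrib (fun z : (Fin S → ProbabilityMeasure Ξ) × GroupedData Ξ N => z.1 s)
      Prod.snd post (Q ⊗ₘ samplingKernel N)) (hα : 0 < α s) (i : Fin (N s)) :
    ∀ᵐ x ∂Q.bind (samplingKernel N),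
      1 ≤ (ENNReal.ofReal (α s) + N s) * ∫⁻ p, (p : Measure Ξ) {x s i} ∂post x := by
  have := hQ.isProbabilityMeasure
  let g : GroupedData Ξ N × ProbabilityMeasure Ξ → ENNReal := fun z => (z.2 : Measure Ξ) {z.1 s i}
  -- The singleton moves with the sample; joint measurability comes from measurability of the
  -- diagonal in a standard Borel space.
  have hg : Measurable g := by
    let κ : Kernel (GroupedData Ξ N × ProbabilityMeasure Ξ) Ξ := (evalKernel Ξ).comap (fun z : GroupedData Ξ N × ProbabilityMeasure Ξ => z.2)
      measurable_snd
    have ht : MeasurableSet {w : (GroupedData Ξ N × ProbabilityMeasure Ξ) × Ξ |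
        w.2 = w.1.1 s i} := measurableSet_eq_fun (by fun_prop) (by fun_prop)
    exact Kernel.measurable_kernel_prodMk_left (κ := κ) ht
  have hsnd : (Q ⊗ₘ samplingKernel (Ξ := Ξ) N).map Prod.snd = Q.bind (samplingKernel N) :=
    Measure.snd_compProd _ _
  have hlaw := hpost.map_eq
  rw [hsnd] at hlaw
  refine ae_le_of_forall_setLIntegral_le_of_sigmaFinite measurable_const fun E hE _ => ?_
  have hT : MeasurableSet {w : Ξ × GroupedData Ξ N | w.1 = w.2 s i ∧ w.2 ∈ E} :=
    (measurableSet_eq_fun (by fun_prop) (by fun_prop)).inter (measurable_snd hE)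
  have hle := hQ.map_bind_samplingKernel_le hα i {w : Ξ × GroupedData Ξ N | w.1 = w.2 s i ∧ w.2 ∈ E}
  have hxm : Measurable fun x : GroupedData Ξ N => (x s i, x) := by fun_prop
  rw [Measure.map_apply hxm hT, Measure.smul_apply, smul_eq_mul] at hle
  rw [setLIntegral_const, one_mul,
    lintegral_const_mul _ (hg.lintegral_kernel_prod_right' (κ := post))]
  refine (le_of_eq ?_).trans (hle.trans_eq ?_)
  · congr 1
    ext x
    simp
  congr 1
  have hgE : Measurable fun z : GroupedData Ξ N × ProbabilityMeasure Ξ =>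
      E.indicator 1 z.1 * g z :=
    ((measurable_one.indicator hE).comp measurable_fst).mul hg
  have hpair : Measurable fun z : (Fin S → ProbabilityMeasure Ξ) × GroupedData Ξ N =>
      (z.2, z.1 s) := by fun_prop
  have hpost_side : ∫⁻ z, E.indicator 1 z.1 * g z ∂(Q.bind (samplingKernel N) ⊗ₘ post) =
      ∫⁻ x in E, ∫⁻ p, (p : Measure Ξ) {x s i} ∂post x ∂Q.bind (samplingKernel N) := by
    rw [Measure.lintegral_compProd hgE, ← lintegral_indicator hE]
    refine lintegral_congr fun x => ?_
    by_cases hx : x ∈ E <;> simp [hx, g]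
  rw [← hpost_side, ← hlaw, lintegral_map hgE hpair]
  refine Eq.trans ?_ (Measure.lintegral_compProd (hgE.comp hpair)).symm
  rw [Measure.bind_apply hT (Kernel.aemeasurable _)]
  refine lintegral_congr fun p => ?_
  rw [predictiveKernel_apply, Measure.prod_apply_symm hT]
  refine lintegral_congr fun x => ?_
  by_cases hx : x ∈ E
  · simp [hx, g]
  · simp [hx]

end HierarchicalDirichletProcess

/-! ### Derivative bounds for `φ` and the two Jensen inequalities. -/

section Transformation

variable {φ : ℝ → ℝ} {K : ℝ}

theorem ContDiffOn.hasDerivAt_deriv_Ioo (hφ : ContDiffOn ℝ 2 φ (Ioo 0 K)) {t : ℝ}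
    (ht : t ∈ Ioo 0 K) :
    HasDerivAt φ (deriv φ t) t ∧ HasDerivAt (deriv φ) (deriv (deriv φ) t) t := by
  have h2 : ContDiffOn ℝ (1 + 1) φ (Ioo 0 K) := by
    norm_num
    exact hφ
  have h1 := ((contDiffOn_succ_iff_deriv_of_isOpen isOpen_Ioo).1 h2)
  exact ⟨(h1.1.differentiableAt (isOpen_Ioo.mem_nhds ht)).hasDerivAt,
    ((h1.2.2.differentiableOn (by simp)).differentiableAt (isOpen_Ioo.mem_nhds ht)).hasDerivAt⟩

theorem monotoneOn_deriv_Ioo (hφ_conv : ConvexOn ℝ (Icc 0 K) φ)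
    (hφ_diff : ContDiffOn ℝ 2 φ (Ioo 0 K)) : MonotoneOn (deriv φ) (Ioo 0 K) :=
  (hφ_conv.subset Ioo_subset_Icc_self (convex_Ioo 0 K)).monotoneOn_deriv fun _ ht =>
    (hφ_diff.hasDerivAt_deriv_Ioo ht).1.differentiableAt

theorem supDeriv2_nonneg (hK : 0 < K) (hφ_conv : ConvexOn ℝ (Icc 0 K) φ)
    (hφ_diff : ContDiffOn ℝ 2 φ (Ioo 0 K)) (hφ_bdd : BddAbove (deriv (deriv φ) '' Ioo 0 K)) :
    0 ≤ supDeriv2 φ K := by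
  have hmid : K / 2 ∈ Ioo 0 K := ⟨by linarith, by linarith⟩
  refine le_trans ?_ (le_csSup hφ_bdd (mem_image_of_mem _ hmid))
  rw [← derivWithin_of_isOpen isOpen_Ioo hmid]
  exact (monotoneOn_deriv_Ioo hφ_conv hφ_diff).derivWithin_nonneg

/-- By convexity only points to the right of `K / 2` matter, and there the bound on `φ''` controls
the growth of `φ'`. This makes `supDeriv` a genuine supremum. -/
theorem bddAbove_deriv_image (hK : 0 < K) (hφ_conv : ConvexOn ℝ (Icc 0 K) φ)
    (hφ_diff : ContDiffOn ℝ 2 φ (Ioo 0 K)) (hφ_bdd : BddAbove (deriv (deriv φ) '' Ioo 0 K)) :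
    BddAbove (deriv φ '' Ioo 0 K) := by
  have hmid : K / 2 ∈ Ioo 0 K := ⟨by linarith, by linarith⟩
  have hS := supDeriv2_nonneg hK hφ_conv hφ_diff hφ_bdd
  refine ⟨deriv φ (K / 2) + supDeriv2 φ K * K, ?_⟩
  rintro _ ⟨t, ht, rfl⟩
  rcases le_total t (K / 2) with h | h
  · have := monotoneOn_deriv_Ioo hφ_conv hφ_diff ht hmid h
    nlinarith
  · have hslope := (convex_Ioo 0 K).image_sub_le_mul_sub_of_deriv_le (f := deriv φ)
      (C := supDeriv2 φ K)
      (fun x hx => (hφ_diff.hasDerivAt_deriv_Ioo hx).2.continuousAt.continuousWithinAt)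
      (fun x hx => (hφ_diff.hasDerivAt_deriv_Ioo
        (interior_subset hx)).2.differentiableAt.differentiableWithinAt)
      (fun x hx => le_csSup hφ_bdd (mem_image_of_mem _ (interior_subset hx)))
      _ hmid _ ht h
    have : supDeriv2 φ K * (t - K / 2) ≤ supDeriv2 φ K * K :=
      mul_le_mul_of_nonneg_left (by linarith [ht.2]) hS
    linarith

theorem supDeriv_pos (hK : 0 < K) (hφ_cont : ContinuousOn φ (Icc 0 K))
    (hφ_mono : StrictMonoOn φ (Icc 0 K)) (hφ_diff : ContDiffOn ℝ 2 φ (Ioo 0 K))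
    (hbdd : BddAbove (deriv φ '' Ioo 0 K)) : 0 < supDeriv φ K := by
  obtain ⟨c, hc, hslope⟩ := exists_deriv_eq_slope φ hK hφ_cont fun t ht =>
    (hφ_diff.hasDerivAt_deriv_Ioo ht).1.differentiableAt.differentiableWithinAt
  refine lt_of_lt_of_le ?_ (le_csSup hbdd (mem_image_of_mem _ hc))
  rw [hslope]
  exact div_pos (sub_pos.2 (hφ_mono ⟨le_rfl, hK.le⟩ ⟨hK.le, le_rfl⟩ hK)) (by linarith)

theorem sub_le_supDeriv_mul (hφ_cont : ContinuousOn φ (Icc 0 K))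
    (hφ_mono : StrictMonoOn φ (Icc 0 K)) (hφ_diff : ContDiffOn ℝ 2 φ (Ioo 0 K))
    (hbdd : BddAbove (deriv φ '' Ioo 0 K)) (hF : 0 < supDeriv φ K) {x y : ℝ} (hx : x ∈ Icc 0 K)
    (hy : y ∈ Icc 0 K) : φ y - φ x ≤ supDeriv φ K * |y - x| := by
  rcases le_total x y with h | h
  · rw [abs_of_nonneg (sub_nonneg.2 h)]
    refine (convex_Icc 0 K).image_sub_le_mul_sub_of_deriv_le hφ_cont ?_ ?_ x hx y hy h
    · intro t ht
      rw [interior_Icc] at ht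
      exact (hφ_diff.hasDerivAt_deriv_Ioo ht).1.differentiableAt.differentiableWithinAt
    · intro t ht
      rw [interior_Icc] at ht
      exact le_csSup hbdd (mem_image_of_mem _ ht)
  · have := hφ_mono.monotoneOn hy hx h
    have : 0 ≤ supDeriv φ K * |y - x| := by positivity
    linarith

/-- Its second derivative is `S_φ - φ''`, which is nonnegative. Jensen's inequality for this
function is a reverse Jensen inequality for `φ`. -/
theorem convexOn_supDeriv2_mul_sq_sub (hφ_cont : ContinuousOn φ (Icc 0 K))
    (hφ_diff : ContDiffOn ℝ 2 φ (Ioo 0 K)) (hφ_bdd : BddAbove (deriv (deriv φ) '' Ioo 0 K)) :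
    ConvexOn ℝ (Icc 0 K) fun t => supDeriv2 φ K / 2 * t ^ 2 - φ t := by
  refine convexOn_of_hasDerivWithinAt2_nonneg (convex_Icc 0 K)
    (f' := fun t => supDeriv2 φ K * t - deriv φ t)
    (f'' := fun t => supDeriv2 φ K - deriv (deriv φ) t) (by fun_prop) ?_ ?_ ?_
  · intro t ht
    rw [interior_Icc] at ht
    have h := (((hasDerivAt_id t).pow 2).const_mul (supDeriv2 φ K / 2)).sub
      (hφ_diff.hasDerivAt_deriv_Ioo ht).1
    refine HasDerivAt.hasDerivWithinAt ?_
    convert h using 1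
    · rfl
    · simp only [id, Nat.cast_ofNat]
      ring
  · intro t ht
    rw [interior_Icc] at ht
    have h := ((hasDerivAt_id t).const_mul (supDeriv2 φ K)).sub
      (hφ_diff.hasDerivAt_deriv_Ioo ht).2
    refine HasDerivAt.hasDerivWithinAt ?_
    convert h using 1
    · rfl
    · rw [mul_one]
  · intro t ht
    rw [interior_Icc] at ht
    exact sub_nonneg.2 (le_csSup hφ_bdd (mem_image_of_mem _ ht))

variable {Y : Type*} [MeasurableSpace Y] {q : Measure Y} [IsProbabilityMeasure q] {X : Y → ℝ}

theorem integrable_comp_of_mem_Icc (hK : 0 < K) (hφ_cont : ContinuousOn φ (Icc 0 K))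
    (hX : Measurable X) (hXK : ∀ y, X y ∈ Icc 0 K) : Integrable (fun y => φ (X y)) q := by
  -- Nothing is known about `φ` outside `[0, K]`, so measurability goes through its constant
  -- extension.
  have hext : Continuous (IccExtend hK.le ((Icc 0 K).domRestrict φ)) :=
    (continuousOn_iff_continuous_domRestrict.1 hφ_cont).Icc_extend'
  have hcomp : (fun y => φ (X y)) = IccExtend hK.le ((Icc 0 K).domRestrict φ) ∘ X := by
    ext y
    rw [Function.comp_apply, IccExtend_of_mem _ _ (hXK y), domRestrict_apply]
  obtain ⟨C, hC⟩ := isCompact_Icc.exists_bound_of_continuousOn hφ_cont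
  refine Integrable.of_bound (C := C) ?_ (Filter.Eventually.of_forall fun y => hC _ (hXK y))
  rw [hcomp]
  exact (hext.measurable.comp hX).aestronglyMeasurable

theorem integrable_of_mem_Icc (hK : 0 < K) (hX : Measurable X) (hXK : ∀ y, X y ∈ Icc 0 K) :
    Integrable X q :=
  integrable_comp_of_mem_Icc (φ := id) hK continuousOn_id hX hXK

theorem integral_mem_Icc (hK : 0 < K) (hX : Measurable X) (hXK : ∀ y, X y ∈ Icc 0 K) :
    ∫ y, X y ∂q ∈ Icc 0 K := by
  refine ⟨integral_nonneg fun y => (hXK y).1, ?_⟩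
  have h := integral_mono (μ := q) (integrable_of_mem_Icc hK hX hXK)
    (integrable_const K) fun y => (hXK y).2
  simpa using h

theorem comp_integral_le_integral_comp (hK : 0 < K) (hφ_cont : ContinuousOn φ (Icc 0 K))
    (hφ_conv : ConvexOn ℝ (Icc 0 K) φ) (hX : Measurable X) (hXK : ∀ y, X y ∈ Icc 0 K) :
    φ (∫ y, X y ∂q) ≤ ∫ y, φ (X y) ∂q :=
  hφ_conv.map_integral_le hφ_cont isClosed_Icc (Filter.Eventually.of_forall hXK)
    (integrable_of_mem_Icc hK hX hXK)
    (integrable_comp_of_mem_Icc hK hφ_cont hX hXK)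

/-- The Jensen gap of a convex function is controlled by its second derivative. -/
theorem integral_comp_le_comp_integral_add (hK : 0 < K) (hφ_cont : ContinuousOn φ (Icc 0 K))
    (hφ_conv : ConvexOn ℝ (Icc 0 K) φ) (hφ_diff : ContDiffOn ℝ 2 φ (Ioo 0 K))
    (hφ_bdd : BddAbove (deriv (deriv φ) '' Ioo 0 K)) (hX : Measurable X)
    (hXK : ∀ y, X y ∈ Icc 0 K) :
    ∫ y, φ (X y) ∂q ≤ φ (∫ y, X y ∂q) + K ^ 2 / 2 * supDeriv2 φ K := by
  have hS := supDeriv2_nonneg hK hφ_conv hφ_diff hφ_bdd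
  -- This bounds the gap by `S_φ / 2` times the variance of `X`; below, the variance is estimated by
  -- `K ^ 2`.
  have h := comp_integral_le_integral_comp (q := q) hK (by fun_prop)
    (convexOn_supDeriv2_mul_sq_sub hφ_cont hφ_diff hφ_bdd) hX hXK
  have hsq : Integrable (fun y => supDeriv2 φ K / 2 * X y ^ 2) q :=
    integrable_comp_of_mem_Icc (φ := fun t => supDeriv2 φ K / 2 * t ^ 2) hK (by fun_prop) hX hXK
  rw [integral_sub hsq (integrable_comp_of_mem_Icc hK hφ_cont hX hXK)] at h
  have hbound : ∫ y, supDeriv2 φ K / 2 * X y ^ 2 ∂q ≤ supDeriv2 φ K / 2 * K ^ 2 := by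
    have := integral_mono hsq (integrable_const (supDeriv2 φ K / 2 * K ^ 2)) fun y =>
      mul_le_mul_of_nonneg_left (pow_le_pow_left₀ (hXK y).1 (hXK y).2 2) (by positivity)
    simpa using this
  have : 0 ≤ supDeriv2 φ K / 2 * (∫ y, X y ∂q) ^ 2 := by positivity
  linarith

end Transformation

/-! ### Risks under the mean measure and the deterministic comparison. -/

section Risk

variable {Ξ Θ : Type*} [MeasurableSpace Ξ] {h : Θ → Ξ → ℝ} {K : ℝ}

theorem risk_mem_Icc (hh : ∀ θ, Measurable (h θ)) (hK : 0 < K) (hrange : ∀ θ x, h θ x ∈ Icc 0 K)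
    (p : Measure Ξ) [IsProbabilityMeasure p] (θ : Θ) : risk h p θ ∈ Icc 0 K :=
  integral_mem_Icc hK (hh θ) (hrange θ)

theorem ofReal_risk (hh : ∀ θ, Measurable (h θ)) (hK : 0 < K) (hrange : ∀ θ x, h θ x ∈ Icc 0 K)
    (p : Measure Ξ) [IsProbabilityMeasure p] (θ : Θ) :
    ENNReal.ofReal (risk h p θ) = ∫⁻ x, ENNReal.ofReal (h θ x) ∂p :=
  ofReal_integral_eq_lintegral_ofReal
    (integrable_of_mem_Icc hK (hh θ) (hrange θ))
    (Filter.Eventually.of_forall fun x => (hrange θ x).1)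

theorem measurable_risk (hh : ∀ θ, Measurable (h θ)) (hK : 0 < K)
    (hrange : ∀ θ x, h θ x ∈ Icc 0 K) (θ : Θ) :
    Measurable fun p : ProbabilityMeasure Ξ => risk h (p : Measure Ξ) θ := by
  have : (fun p : ProbabilityMeasure Ξ => risk h (p : Measure Ξ) θ) =
      fun p : ProbabilityMeasure Ξ =>
        (∫⁻ x, ENNReal.ofReal (h θ x) ∂(p : Measure Ξ)).toReal := by
    ext p
    rw [← ofReal_risk hh hK hrange, ENNReal.toReal_ofReal (risk_mem_Icc hh hK hrange _ θ).1]
  rw [this]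
  exact ((Measure.measurable_lintegral (hh θ).ennreal_ofReal).comp
    measurable_subtype_coe).ennreal_toReal

/-- The risk is linear in `p`, so its average under `q` is the risk at the mean measure of `q`. -/
theorem integral_risk (hh : ∀ θ, Measurable (h θ)) (hK : 0 < K)
    (hrange : ∀ θ x, h θ x ∈ Icc 0 K) (q : Measure (ProbabilityMeasure Ξ))
    [IsProbabilityMeasure q] (θ : Θ) :
    ∫ p, risk h (p : Measure Ξ) θ ∂q = risk h (q.bind (evalKernel Ξ)) θ := by
  rw [← ENNReal.ofReal_eq_ofReal_iff (integral_nonneg fun p => (risk_mem_Icc hh hK hrange _ θ).1)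
    (risk_mem_Icc hh hK hrange _ θ).1, ofReal_risk hh hK hrange,
    Measure.lintegral_bind (Kernel.aemeasurable _) (hh θ).ennreal_ofReal.aemeasurable,
    ofReal_integral_eq_lintegral_ofReal (integrable_of_mem_Icc hK
      (measurable_risk hh hK hrange θ) fun p => risk_mem_Icc hh hK hrange _ θ)
    (Filter.Eventually.of_forall fun p => (risk_mem_Icc hh hK hrange _ θ).1)]
  exact lintegral_congr fun p => ofReal_risk hh hK hrange p θ

/-- If `m` dominates the fraction `w` of `e`, then the risks under `m` and `e` are close. -/
theorem abs_risk_sub_risk_le (hh : ∀ θ, Measurable (h θ)) (hK : 0 < K)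
    (hrange : ∀ θ x, h θ x ∈ Icc 0 K) {m e p : Measure Ξ} [IsProbabilityMeasure m]
    [IsProbabilityMeasure e] [IsProbabilityMeasure p] {w : ℝ} (hw : 0 ≤ w) (hw1 : w ≤ 1)
    (hle : ENNReal.ofReal w • e ≤ m) (θ : Θ) :
    |risk h m θ - risk h p θ| ≤ w * |risk h e θ - risk h p θ| + (1 - w) * K := by
  have hint : ∀ ν : Measure Ξ, IsProbabilityMeasure ν → Integrable (h θ) ν := fun ν _ =>
    integrable_of_mem_Icc hK (hh θ) (hrange θ)
  have hmono : ∀ f : Ξ → ℝ, (∀ x, 0 ≤ f x) → Integrable f m → w * ∫ x, f x ∂e ≤ ∫ x, f x ∂m := by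
    intro f hf hfm
    have := integral_mono_measure hle (Filter.Eventually.of_forall hf) hfm
    rwa [integral_smul_measure, ENNReal.toReal_ofReal hw, smul_eq_mul] at this
  have h1 : w * risk h e θ ≤ risk h m θ := hmono _ (fun x => (hrange θ x).1) (hint m inferInstance)
  -- Domination is applied to `K - h θ` as well, which gives the bound from the other side.
  have h2 : w * (K - risk h e θ) ≤ K - risk h m θ := by
    have := hmono (fun x => K - h θ x) (fun x => sub_nonneg.2 (hrange θ x).2)
      ((integrable_const K).sub (hint m inferInstance))
    rw [integral_sub (integrable_const K) (hint e inferInstance),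
      integral_sub (integrable_const K) (hint m inferInstance)] at this
    simpa [risk] using this
  have hp := risk_mem_Icc hh hK hrange p θ
  have h3 := mul_le_mul_of_nonneg_left (le_abs_self (risk h e θ - risk h p θ)) hw
  have h4 := mul_le_mul_of_nonneg_left (neg_abs_le (risk h e θ - risk h p θ)) hw
  have h5 := mul_nonneg (sub_nonneg.2 hw1) hp.1
  have h6 := mul_nonneg (sub_nonneg.2 hw1) (sub_nonneg.2 hp.2)
  rw [abs_le]
  constructor <;> nlinarith

/-- Jensen's inequality is used at the minimizer and its reverse at the competitor; passing between
the mean measure and `p` costs `F_φ * η` at each of the two points. -/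
theorem comp_risk_minimizer_sub_le (hh : ∀ θ, Measurable (h θ)) (hK : 0 < K)
    (hrange : ∀ θ x, h θ x ∈ Icc 0 K) {φ : ℝ → ℝ} (hφ_cont : ContinuousOn φ (Icc 0 K))
    (hφ_mono : StrictMonoOn φ (Icc 0 K)) (hφ_conv : ConvexOn ℝ (Icc 0 K) φ)
    (hφ_diff : ContDiffOn ℝ 2 φ (Ioo 0 K)) (hφ_bdd : BddAbove (deriv (deriv φ) '' Ioo 0 K))
    {q : Measure (ProbabilityMeasure Ξ)} [IsProbabilityMeasure q] {p : Measure Ξ}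
    [IsProbabilityMeasure p] {η : ℝ}
    (hη : ∀ θ, |risk h (q.bind (evalKernel Ξ)) θ - risk h p θ| ≤ η) {θmin : Θ}
    (hmin : IsMinOn (criterion φ h q) univ θmin) (θ : Θ) :
    φ (risk h p θmin) - φ (risk h p θ) ≤ 2 * supDeriv φ K * η + K ^ 2 / 2 * supDeriv2 φ K := by
  have hbdd := bddAbove_deriv_image hK hφ_conv hφ_diff hφ_bdd
  have hF := supDeriv_pos hK hφ_cont hφ_mono hφ_diff hbdd
  have hlower := comp_integral_le_integral_comp (q := q) hK hφ_cont hφ_conv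
    (measurable_risk hh hK hrange θmin) fun p => risk_mem_Icc hh hK hrange _ θmin
  have hupper := integral_comp_le_comp_integral_add (q := q) hK hφ_cont hφ_conv hφ_diff hφ_bdd
    (measurable_risk hh hK hrange θ) fun p => risk_mem_Icc hh hK hrange _ θ
  rw [integral_risk hh hK hrange] at hlower hupper
  have hopt : ∫ p, φ (risk h (p : Measure Ξ) θmin) ∂q ≤ ∫ p, φ (risk h (p : Measure Ξ) θ) ∂q :=
    hmin (mem_univ θ)
  have h1 := sub_le_supDeriv_mul hφ_cont hφ_mono hφ_diff hbdd hF
    (risk_mem_Icc hh hK hrange (q.bind (evalKernel Ξ)) θmin) (risk_mem_Icc hh hK hrange p θmin)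
  have h2 := sub_le_supDeriv_mul hφ_cont hφ_mono hφ_diff hbdd hF
    (risk_mem_Icc hh hK hrange p θ) (risk_mem_Icc hh hK hrange (q.bind (evalKernel Ξ)) θ)
  have h3 := mul_le_mul_of_nonneg_left (hη θ) hF.le
  have h4 := mul_le_mul_of_nonneg_left (hη θmin) hF.le
  rw [abs_sub_comm] at h1
  linarith

end Risk

/-! ### From posterior atoms to domination of the empirical measure. -/

section Posterior

variable {Ξ : Type*} [MeasurableSpace Ξ] {S : ℕ} {N : Fin S → ℕ} {α₀ : ℝ} {α : Fin S → ℝ}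
  {H : Measure Ξ}

theorem isProbabilityMeasure_updatedBase {ι : Type*} [Fintype ι] {a : ℝ} (ha : 0 < a)
    (P : Measure Ξ) [IsProbabilityMeasure P] (y : ι → Ξ) :
    IsProbabilityMeasure (updatedBase a P y) := by
  refine ⟨?_⟩
  have hpos : 0 < a + Fintype.card ι := by positivity
  have hcard : ENNReal.ofReal a + Fintype.card ι = ENNReal.ofReal (a + Fintype.card ι) := by
    rw [ENNReal.ofReal_add ha.le (by positivity), ENNReal.ofReal_natCast]
  simp only [updatedBase, Measure.smul_apply, Measure.add_apply, Measure.finsetSum_apply,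
    measure_univ, smul_eq_mul, mul_one, Finset.sum_const, Finset.card_univ, nsmul_eq_mul]
  rw [hcard, ← ENNReal.ofReal_mul (by positivity), one_div, inv_mul_cancel₀ hpos.ne',
    ENNReal.ofReal_one]

theorem isProbabilityMeasure_empiricalMeasure {n : ℕ} (hn : 0 < n) (y : Fin n → Ξ) :
    IsProbabilityMeasure (empiricalMeasure y) := by
  refine ⟨?_⟩
  simp only [empiricalMeasure, Measure.smul_apply, Measure.finsetSum_apply,
    measure_univ, smul_eq_mul, Finset.sum_const, Finset.card_univ, nsmul_eq_mul, mul_one,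
    Fintype.card_fin]
  rw [← ENNReal.ofReal_natCast, ← ENNReal.ofReal_mul (by positivity), one_div,
    inv_mul_cancel₀ (by positivity), ENNReal.ofReal_one]

/-- Whatever `p₀` is, the second stage has as mean the updated centering measure, which contains
`δ_{x s i} / (α s + N s)`. -/
theorem IsTwoStageLaw.one_le_mul_lintegral_singleton [MeasurableSingletonClass Ξ] {s : Fin S}
    (hα : 0 < α s) {x : GroupedData Ξ N} {q : Measure (ProbabilityMeasure Ξ)}
    (hq : IsTwoStageLaw α₀ α H s x q) (i : Fin (N s)) :
    1 ≤ (ENNReal.ofReal (α s) + N s) * ∫⁻ p, (p : Measure Ξ) {x s i} ∂q := by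
  obtain ⟨D₀, κ, hD₀, hκ, rfl⟩ := hq
  have := hD₀.isProbabilityMeasure
  have hcard : ENNReal.ofReal (α s) + N s = ENNReal.ofReal (α s + N s) := by
    rw [ENNReal.ofReal_add hα.le (by positivity), ENNReal.ofReal_natCast]
  have hpos : 0 < α s + N s := by positivity
  rw [Measure.lintegral_bind κ.aemeasurable
    (measurable_probabilityMeasure_coe_apply (measurableSet_singleton _)).aemeasurable]
  have hmean : ∀ p₀ : ProbabilityMeasure Ξ,
      (ENNReal.ofReal (α s) + N s)⁻¹ ≤ ∫⁻ p, (p : Measure Ξ) {x s i} ∂κ p₀ := by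
    intro p₀
    have := isProbabilityMeasure_updatedBase hα (p₀ : Measure Ξ) (x s)
    rw [(hκ p₀).lintegral_apply (by positivity) (measurableSet_singleton _), updatedBase,
      Fintype.card_fin, hcard, ← ENNReal.ofReal_inv_of_pos hpos, one_div]
    simp only [Measure.smul_apply, Measure.add_apply, Measure.finsetSum_apply, smul_eq_mul]
    refine le_mul_of_one_le_right zero_le ?_
    refine le_add_left ((Finset.single_le_sum (fun _ _ => zero_le) (Finset.mem_univ i)).trans' ?_)
    simp
  calc (1 : ENNReal) = (ENNReal.ofReal (α s) + N s) * ∫⁻ _, (ENNReal.ofReal (α s) + N s)⁻¹ ∂D₀ := by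
        rw [lintegral_const, measure_univ, mul_one, hcard,
          ENNReal.mul_inv_cancel (by simpa using hpos) ENNReal.ofReal_ne_top]
    _ ≤ _ := by
        gcongr with p₀
        exact hmean p₀

/-- Without ties the atoms are disjoint, so their masses add up inside any measurable set. -/
theorem smul_empiricalMeasure_le [MeasurableSingletonClass Ξ] {n : ℕ} (hn : 0 < n) {a : ℝ}
    (ha : 0 < a) {y : Fin n → Ξ} (hy : Function.Injective y) {m : Measure Ξ}
    (hm : ∀ i, 1 ≤ (ENNReal.ofReal a + n) * m {y i}) :
    ENNReal.ofReal (n / (a + n)) • empiricalMeasure y ≤ m := by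
  classical
  have hpos : 0 < a + n := by positivity
  have hcard : ENNReal.ofReal a + n = ENNReal.ofReal (a + n) := by
    rw [ENNReal.ofReal_add ha.le (by positivity), ENNReal.ofReal_natCast]
  have hm' : ∀ i, ENNReal.ofReal (1 / (a + n)) ≤ m {y i} := by
    intro i
    have h := hm i
    rwa [hcard, ← ENNReal.inv_le_iff_le_mul (fun _ => by simpa using hpos)
      (fun h => absurd h ENNReal.ofReal_ne_top), ← ENNReal.ofReal_inv_of_pos hpos,
      ← one_div] at h
  refine Measure.le_iff.2 fun A hA => ?_
  have hscale : ENNReal.ofReal (n / (a + n)) * ENNReal.ofReal (1 / n) =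
      ENNReal.ofReal (1 / (a + n)) := by
    rw [← ENNReal.ofReal_mul (by positivity)]
    congr 1
    field_simp
  rw [empiricalMeasure, smul_smul, hscale, Measure.smul_apply, Measure.finsetSum_apply,
    smul_eq_mul, Finset.mul_sum]
  calc ∑ i, ENNReal.ofReal (1 / (a + n)) * Measure.dirac (y i) A
      ≤ ∑ i, if y i ∈ A then m {y i} else 0 := by
        refine Finset.sum_le_sum fun i _ => ?_
        rw [Measure.dirac_apply' _ hA]
        by_cases h : y i ∈ A
        · simpa [h] using hm' i
        · simp [h]
    _ = m (⋃ i ∈ Finset.univ.filter fun i => y i ∈ A, {y i}) := by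
        rw [← Finset.sum_filter, measure_biUnion_finset _ fun i _ => measurableSet_singleton _]
        intro i _ j _ hij
        simpa using hy.ne hij
    _ ≤ m A := by
        refine measure_mono ?_
        simp

end Posterior

/-! ### Absence of ties and the joint law of the data. -/

section Data

variable {Ξ : Type*} [MeasurableSpace Ξ] {Ω : Type*} [MeasurableSpace Ω] {μ : Measure Ω}
  [IsProbabilityMeasure μ]

/-- By Fubini, the diagonal is null for a product of diffuse laws; there are countably many pairs.
-/
theorem ae_injective_of_iIndepFun [StandardBorelSpace Ξ] {ι : Type*} [Countable ι]
    {X : ι → Ω → Ξ} (hX : ∀ i, Measurable (X i)) (hdiffuse : ∀ i x, μ.map (X i) {x} = 0)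
    (hindep : iIndepFun X μ) : ∀ᵐ ω ∂μ, Function.Injective fun i => X i ω := by
  have hne : ∀ᵐ ω ∂μ, ∀ i j, i ≠ j → X i ω ≠ X j ω := by
    refine ae_all_iff.2 fun i => ae_all_iff.2 fun j => ?_
    rcases eq_or_ne i j with hij | hij
    · exact Filter.Eventually.of_forall fun _ h => absurd hij h
    have hlaw := (indepFun_iff_map_prod_eq_prod_map_map (hX i).aemeasurable
      (hX j).aemeasurable).1 (hindep.indepFun hij)
    have hdiag : MeasurableSet {w : Ξ × Ξ | w.1 = w.2} :=
      measurableSet_eq_fun measurable_fst measurable_snd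
    have hnull : μ.map (fun ω => (X i ω, X j ω)) {w : Ξ × Ξ | w.1 = w.2} = 0 := by
      have := Measure.isProbabilityMeasure_map (μ := μ) (hX j).aemeasurable
      rw [hlaw, Measure.prod_apply hdiag]
      have : ∀ x : Ξ, Prod.mk x ⁻¹' {w : Ξ × Ξ | w.1 = w.2} = {x} := by
        intro x
        ext y
        simp [eq_comm]
      simp [this, hdiffuse]
    rw [Measure.map_apply ((hX i).prodMk (hX j)) hdiag] at hnull
    filter_upwards [measure_eq_zero_iff_ae_notMem.1 hnull] with ω hω _ h
    exact hω h
  filter_upwards [hne] with ω hω i j h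
  by_contra hij
  exact hω i j hij h

theorem map_groupedData_eq_pi {S : ℕ} {N : Fin S → ℕ} {pstar : Fin S → Measure Ξ}
    [∀ ℓ, IsProbabilityMeasure (pstar ℓ)] {ξ : (ℓ : Fin S) → Fin (N ℓ) → Ω → Ξ}
    (hξ : ∀ ℓ j, Measurable (ξ ℓ j)) (hξ_law : ∀ ℓ j, μ.map (ξ ℓ j) = pstar ℓ)
    (hξ_indep : iIndepFun (fun i : (Σ ℓ : Fin S, Fin (N ℓ)) => ξ i.1 i.2) μ) :
    μ.map (fun ω ℓ j => ξ ℓ j ω) = Measure.pi fun ℓ => Measure.pi fun _ : Fin (N ℓ) => pstar ℓ := by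
  have h := (iIndepFun_iff_map_fun_eq_pi_map
    fun i : (Σ ℓ : Fin S, Fin (N ℓ)) => (hξ i.1 i.2).aemeasurable).1 hξ_indep
  simp_rw [hξ_law] at h
  rw [← map_sigmaCurry_pi (μ := fun ℓ (_ : Fin (N ℓ)) => pstar ℓ), ← h,
    Measure.map_map (by fun_prop) (by fun_prop)]
  rfl

end Data

/-! ### The theorem. -/

theorem mainTheorem3
    -- sample space, parameter set, and the probability space carrying the data
    {Ξ : Type*} [MeasurableSpace Ξ] [StandardBorelSpace Ξ] {Θ : Type*}
    {Ω : Type*} [MeasurableSpace Ω] (μ : Measure Ω) [IsProbabilityMeasure μ]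
    -- groups and sample sizes
    {S : ℕ} (N : Fin S → ℕ) (s : Fin S) (hN : 0 < N s)
    -- the data: independent observations, those of group `ℓ` drawn from the diffuse law `pstar ℓ`
    (pstar : Fin S → Measure Ξ) [∀ ℓ, IsProbabilityMeasure (pstar ℓ)]
    (hpstar : ∀ ℓ (x : Ξ), pstar ℓ {x} = 0)
    (ξ : (ℓ : Fin S) → Fin (N ℓ) → Ω → Ξ) (hξ : ∀ ℓ j, Measurable (ξ ℓ j))
    (hξ_law : ∀ ℓ j, μ.map (ξ ℓ j) = pstar ℓ)
    (hξ_indep : iIndepFun (fun i : (Σ ℓ : Fin S, Fin (N ℓ)) => ξ i.1 i.2) μ)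
    -- hierarchical Dirichlet process prior with diffuse centering measure `H`
    (α₀ : ℝ) (hα₀ : 0 < α₀) (α : Fin S → ℝ) (hα : ∀ ℓ, 0 < α ℓ)
    (H : Measure Ξ) [IsProbabilityMeasure H] (hH : ∀ x : Ξ, H {x} = 0)
    -- the posterior of group `s`; the conditional distribution is only determined up to null sets
    -- of the marginal law of the sample in the Bayesian model, so for true laws not dominated
    -- by `H` the version used is the two-stage one at samples without ties
    (post : Kernel (GroupedData Ξ N) (ProbabilityMeasure Ξ)) [IsMarkovKernel post]
    (hpost : IsHDPPosterior N α₀ α H s post)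
    (hversion : (∀ ℓ, pstar ℓ ≪ H) ∨
      ∀ x : GroupedData Ξ N, Function.Injective (pooled x) →
        IsTwoStageLaw α₀ α H s x (post x))
    -- the loss has range in `[0, K]`
    (h : Θ → Ξ → ℝ) (hh : ∀ θ, Measurable (h θ)) (K : ℝ) (hK : 0 < K)
    (hrange : ∀ θ x, h θ x ∈ Icc 0 K)
    -- the transformation `φ`
    (φ : ℝ → ℝ) (hφ_cont : ContinuousOn φ (Icc 0 K)) (hφ_mono : StrictMonoOn φ (Icc 0 K))
    (hφ_conv : ConvexOn ℝ (Icc 0 K) φ) (hφ_diff : ContDiffOn ℝ 2 φ (Ioo 0 K))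
    (hφ_bdd : BddAbove (deriv (deriv φ) '' Ioo 0 K))
    -- minimizers of the robust criterion and of the true risk
    (θN : Ω → Θ)
    (hθN : ∀ᵐ ω ∂μ, IsMinOn (criterion φ h (post fun ℓ j => ξ ℓ j ω)) univ (θN ω))
    (θstar : Θ) (hθstar : IsMinOn (risk h (pstar s)) univ θstar)
    (δ : ℝ) (hδ : 0 < δ) :
    μ {ω | φ (risk h (pstar s) (θN ω)) - φ (risk h (pstar s) θstar) ≤ δ} ≥
      μ {ω | (⨆ θ, |risk h (empiricalMeasure fun j => ξ s j ω) θ - risk h (pstar s) θ|) ≤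
        (α s + N s) / N s *
          (δ / (2 * supDeriv φ K) - α s / (α s + N s) * K
            - K ^ 2 / 2 * (supDeriv2 φ K / supDeriv φ K))} := by

  have hN' : (0 : ℝ) < N s := by exact_mod_cast hN
  have hαs : 0 < α s := hα s
  have hξm : Measurable fun ω ℓ j => ξ ℓ j ω := by fun_prop
  have hinj : ∀ᵐ ω ∂μ, Function.Injective (pooled fun ℓ j => ξ ℓ j ω) :=
    ae_injective_of_iIndepFun (fun i => hξ i.1 i.2)
      (fun i x => (congrArg (fun ν => ν {x}) (hξ_law i.1 i.2)).trans (hpstar i.1 x)) hξ_indep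
  have hatoms : ∀ᵐ ω ∂μ, ∀ i, 1 ≤ (ENNReal.ofReal (α s) + N s) *
      ∫⁻ p, (p : Measure Ξ) {ξ s i ω} ∂post fun ℓ j => ξ ℓ j ω := by
    rcases hversion with hac | htwo
    · obtain ⟨Q, hQ, hcond⟩ := hpost
      have hdata : μ.map (fun ω ℓ j => ξ ℓ j ω) ≪ Q.bind (samplingKernel N) := by
        rw [map_groupedData_eq_pi hξ hξ_law hξ_indep]
        exact (Measure.AbsolutelyContinuous.pi fun ℓ =>
          Measure.AbsolutelyContinuous.pi fun _ => hac ℓ).trans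
          (hQ.pi_absolutelyContinuous hα₀ hα)
      exact ae_all_iff.2 fun i => ae_of_ae_map hξm.aemeasurable
        (hdata.ae_le (hQ.ae_one_le_mul_lintegral_singleton hcond hαs i))
    · filter_upwards [hinj] with ω hω i
      exact (htwo _ hω).one_le_mul_lintegral_singleton hαs i
  -- Almost sure inclusion is enough, and monotonicity needs no measurability of either event.
  refine measure_mono_ae ?_
  filter_upwards [hinj, hatoms, hθN] with ω hω hatom hmin hsup
  have hsup : (⨆ θ, |risk h (empiricalMeasure fun j => ξ s j ω) θ - risk h (pstar s) θ|) ≤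
      (α s + N s) / N s * (δ / (2 * supDeriv φ K) - α s / (α s + N s) * K
        - K ^ 2 / 2 * (supDeriv2 φ K / supDeriv φ K)) := hsup
  have hemp := isProbabilityMeasure_empiricalMeasure hN fun j => ξ s j ω
  set q := post fun ℓ j => ξ ℓ j ω with hq
  have hle : ENNReal.ofReal (N s / (α s + N s)) • empiricalMeasure (fun j => ξ s j ω) ≤
      q.bind (evalKernel Ξ) := by
    refine smul_empiricalMeasure_le hN hαs (fun i j hij => ?_) fun i => ?_
    · simpa using @hω ⟨s, i⟩ ⟨s, j⟩ hij
    · rw [Measure.bind_apply (measurableSet_singleton _) (Kernel.aemeasurable _)]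
      exact hatom i
  have hF := supDeriv_pos hK hφ_cont hφ_mono hφ_diff
    (bddAbove_deriv_image hK hφ_conv hφ_diff hφ_bdd)
  have hS := supDeriv2_nonneg hK hφ_conv hφ_diff hφ_bdd
  -- A real supremum bounds its terms only when the family is bounded above.
  have hbddabs : BddAbove (range fun θ =>
      |risk h (empiricalMeasure fun j => ξ s j ω) θ - risk h (pstar s) θ|) := by
    refine ⟨K, ?_⟩
    rintro _ ⟨θ, rfl⟩
    have h1 := risk_mem_Icc hh hK hrange (empiricalMeasure fun j => ξ s j ω) θ
    have h2 := risk_mem_Icc hh hK hrange (pstar s) θ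
    exact abs_sub_le_of_nonneg_of_le h1.1 h1.2 h2.1 h2.2
  have hclose : ∀ θ, |risk h (q.bind (evalKernel Ξ)) θ - risk h (pstar s) θ| ≤
      δ / (2 * supDeriv φ K) - K ^ 2 / 2 * (supDeriv2 φ K / supDeriv φ K) := by
    intro θ
    refine (abs_risk_sub_risk_le hh hK hrange (by positivity)
      (div_le_one_of_le₀ (by linarith) (by positivity)) hle θ).trans ?_
    -- The weight `N s / (α s + N s)` cancels the prefactor of the threshold, and the term `α s / (α
    -- s + N s) * K` pays for the mass not dominated.
    have h1 := mul_le_mul_of_nonneg_left ((le_ciSup hbddabs θ).trans hsup)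
      (show (0 : ℝ) ≤ N s / (α s + N s) by positivity)
    have h2 : 1 - N s / (α s + N s) = α s / (α s + N s) := by
      field_simp
      ring
    rw [← mul_assoc, div_mul_div_comm, mul_comm (N s : ℝ), div_self (by positivity), one_mul] at h1
    rw [h2]
    linarith
  refine (comp_risk_minimizer_sub_le hh hK hrange hφ_cont hφ_mono hφ_conv hφ_diff hφ_bdd hclose
    hmin θstar).trans ?_
  -- The threshold reserves `K ^ 2 * S_φ`; the Jensen gap uses half of it and the rest is slack.
  have heq : 2 * supDeriv φ K *
      (δ / (2 * supDeriv φ K) - K ^ 2 / 2 * (supDeriv2 φ K / supDeriv φ K)) =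
        δ - K ^ 2 * supDeriv2 φ K := by
    field_simp
  rw [heq]
  have : 0 ≤ K ^ 2 * supDeriv2 φ K := by positivity
  linarith
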